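/- Let $\mathcal X\subset\mathbb R^d$ be convex, let $f_1,\dots,f_n:\mathcal X\to\mathbb R$ be convex and differentiable, and suppose that $F=\sum_{i=1}^n f_i$ is strongly convex with minimizer $x^\star$ over $\mathcal X$, that $x^\star$ lies in the interior of $\mathcal X$, and that every $\nabla f_i$ is continuously differentiable in a neighbourhood of $x^\star$. Let $\mathcal G$ be a connected simple undirected graph on $\{1,\dots,n\}$ with Laplacian $\mathcal L$, and put $\mathbf L=\mathcal L\otimes I_d$, $\mathbf S=\mathbf L^{1/2}$ (the positive semidefinite square root). Let $\phi:\mathcal X\to\mathbb R$ be closed (i.e. with closed epigraph), $\mu_\phi$-strongly convex for some $\mu_\phi>0$ and differentiable on the interior of $\mathcal X$; suppose that $\phi$ is twice differentiable near $x^\star$ and that $\nabla^2\phi$ is continuously differentiable in a neighbourhood of $x^\star$. Let $\phi^\star(z)=\sup_{x\in\mathcal X}\{\langle x,z\rangle-\phi(x)\}$. For stacked vectors $\mathbf x=\mathrm{col}\{x_1,\dots,x_n\}\in\mathbb R^{nd}$ write $\nabla f(\mathbf x)=\mathrm{col}\{\nabla f_i(x_i)\}$, $\nabla\phi^\star(\mathbf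 z)=\mathrm{col}\{\nabla\phi^\star(z_i)\}$ and $\nabla^2\phi(\mathbf x)=\mathrm{blockdiag}\{\nabla^2\phi(x_i)\}$. Put $\mathbf x^\star=\mathbb 1_n\otimes x^\star$, $\mathbf y^\star=-\nabla f(\mathbf x^\star)$, $\mathbf z^\star=\mathbb 1_n\otimes\nabla\phi(x^\star)$. (a) $(\mathbf z^\star,\mathbf y^\star,\mathbf x^\star)$ is a locally exponentially stable equilibrium of $$\dot{\mathbf z}=-(\nabla f(\mathbf x)+\mathbf L\mathbf x+\mathbf y),\qquad \dot{\mathbf y}=\mathbf L\mathbf x,\qquad \mathbf x=\nabla\phi^\star(\mathbf z)$$ on the invariant set $\{y_1+\dots+y_n=0\}$ (which contains all trajectories with $\mathbf y(0)=0$). (b) Let $r=\frac1{\sqrt n}\mathbb 1_n$, let $R\in\mathbb R^{n\times(n-1)}$ be any matrix such that $Q=[r,R]$ is orthogonal and $\mathcal L=Q\Lambda Q^\top$ with $\Lambda=\mathrm{diag}\{0,\lambda_1,\dots,\lambda_{n-1}\}$, and put $\mathbf R=R\otimes I_d$. Then the origin is a locally exponentially stable equilibrium of $$\dot{\tilde{\mathbf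 x}}=-\nabla^2\phi(\tilde{\mathbf x}+\mathbf x^\star)^{-1}\bigl(\nabla f(\tilde{\mathbf x}+\mathbf x^\star)-\nabla f(\mathbf x^\star)+\mathbf L\tilde{\mathbf x}+\mathbf S\mathbf R\mathbf W_2\bigr),\qquad \dot{\mathbf W}_2=\mathbf R^\top\mathbf S\tilde{\mathbf x}$$ on $\mathbb R^{nd}\times\mathbb R^{(n-1)d}$. Here an equilibrium $e$ is locally exponentially stable (on an invariant set) if there are $\delta,C,\lambda>0$ such that for every initial state $p_0$ (in the invariant set) with $\|p_0-e\|\le\delta$ there is a unique solution $p$ with $p(0)=p_0$, it exists for all $t\ge0$, and $\|p(t)-e\|\le C\|p_0-e\|e^{-\lambda t}$ for all $t\ge 0$. -/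

import Mathlib

open scoped Topology Kronecker MatrixOrder InnerProductSpace

noncomputable section

namespace DMD

/-! ### Local exponential stability -/

/-- Local exponential stability of the equilibrium `e` of a time-invariant system on a normed
space `X`, relative to a set `K` of admissible initial states (`K = Set.univ` is the usual notion).
The system is given through its trajectories: `IsSol J p` says that `p` solves it on the time
interval `J`.

The equilibrium is an admissible constant solution, and every admissible initial state `p₀` in a
ball around `e` has a solution on `[0, ∞)`, which decays to `e` at an exponential rate, and with
which every solution on any `[0, T]` starting at `p₀` agrees. The notion does not change when the
norm is replaced by an equivalent one. -/
def IsLocallyExpStable {X : Type*} [NormedAddCommGroup X]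
    (IsSol : Set ℝ → (ℝ → X) → Prop) (K : Set X) (e : X) : Prop :=
  e ∈ K ∧ IsSol (Set.Ici 0) (fun _ => e) ∧
  ∃ δ > 0, ∃ C > 0, ∃ rate > 0, ∀ p₀ ∈ K, ‖p₀ - e‖ ≤ δ →
    ∃ p : ℝ → X, p 0 = p₀ ∧ IsSol (Set.Ici 0) p ∧
      (∀ t : ℝ, 0 ≤ t → ‖p t - e‖ ≤ C * ‖p₀ - e‖ * Real.exp (-rate * t)) ∧
      (∀ T : ℝ, 0 < T → ∀ q : ℝ → X, q 0 = p₀ → IsSol (Set.Icc 0 T) q →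
        Set.EqOn q p (Set.Icc 0 T))

/-! ### Stacked vectors -/

/-- `ℝᵈ` with the Euclidean norm. -/
abbrev Vec (d : ℕ) : Type := EuclideanSpace ℝ (Fin d)

/-- `ℝⁿᵈ` with the Euclidean norm; the coordinate `(i, k)` is the `k`-th coordinate of agent `i`. -/
abbrev Stack (n d : ℕ) : Type := EuclideanSpace ℝ (Fin n × Fin d)

/-- `col{v₁, …, vₙ}`. -/
def col {n d : ℕ} (v : Fin n → Vec d) : Stack n d :=
  WithLp.toLp 2 fun p => v p.1 p.2

/-- The `i`-th block `xᵢ` of a stacked vector. -/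
def block {n d : ℕ} (x : Stack n d) (i : Fin n) : Vec d :=
  WithLp.toLp 2 fun k => x (i, k)

/-- `A ⊗ I_d`. -/
def kronId {m n : ℕ} (d : ℕ) (A : Matrix (Fin m) (Fin n) ℝ) :
    Matrix (Fin m × Fin d) (Fin n × Fin d) ℝ :=
  A ⊗ₖ (1 : Matrix (Fin d) (Fin d) ℝ)

/-- The action of a matrix on stacked vectors. -/
def act {m n d : ℕ} (A : Matrix (Fin m × Fin d) (Fin n × Fin d) ℝ) (x : Stack n d) : Stack m d :=
  Matrix.toEuclideanLin A x

/-! ### Convex conjugate, gradients and Hessians -/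

/-- The convex conjugate `φ⋆(z) = sup_{x ∈ 𝒳} (⟨x, z⟩ - φ x)`. (For strongly convex `φ` with a
point of differentiability in the interior of `𝒳` the supremum is finite.) -/
def conjugate {d : ℕ} (𝒳 : Set (Vec d)) (φ : Vec d → ℝ) (z : Vec d) : ℝ :=
  ⨆ x : 𝒳, (⟪(x : Vec d), z⟫_ℝ - φ x)

/-- `∇φ⋆(𝐳) = col{∇φ⋆(z₁), …, ∇φ⋆(zₙ)}`. -/
def mirror {n d : ℕ} (𝒳 : Set (Vec d)) (φ : Vec d → ℝ) (z : Stack n d) : Stack n d :=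
  col fun i => gradient (conjugate 𝒳 φ) (block z i)

/-- `∇f(𝐱) = col{∇f₁(x₁), …, ∇fₙ(xₙ)}`, for functions `fᵢ` given on `𝒳`. -/
def gradStack {n d : ℕ} (𝒳 : Set (Vec d)) (f : Fin n → Vec d → ℝ) (x : Stack n d) : Stack n d :=
  col fun i => gradientWithin (f i) 𝒳 (block x i)

/-- The Hessian `∇²φ(x)`, as the derivative of the gradient. -/
def hessian {d : ℕ} (φ : Vec d → ℝ) (x : Vec d) : Vec d →L[ℝ] Vec d :=
  fderiv ℝ (gradient φ) x

/-- `∇²φ(𝐱)⁻¹ 𝐯`, where `∇²φ(𝐱)` is block diagonal with blocks `∇²φ(x₁), …, ∇²φ(xₙ)`. -/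
def invHessianStack {n d : ℕ} (φ : Vec d → ℝ) (x v : Stack n d) : Stack n d :=
  col fun i => (hessian φ (block x i)).inverse (block v i)

/-! ### The network -/

/-- `𝐋 = ℒ ⊗ I_d`, with `ℒ` the graph Laplacian. -/
def bigLap {n : ℕ} (d : ℕ) (G : SimpleGraph (Fin n)) [DecidableRel G.Adj] :
    Matrix (Fin n × Fin d) (Fin n × Fin d) ℝ :=
  kronId d (G.lapMatrix ℝ)

/-- `𝐒 = 𝐋^{1/2}`, the positive semidefinite square root. -/
def sqrtLap {n : ℕ} (d : ℕ) (G : SimpleGraph (Fin n)) [DecidableRel G.Adj] :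
    Matrix (Fin n × Fin d) (Fin n × Fin d) ℝ :=
  CFC.sqrt (bigLap d G)

/-- `[r, R]`, with first column `r = 𝟙ₙ / √n`. -/
def extendCols {n : ℕ} (R : Matrix (Fin n) (Fin (n - 1)) ℝ) :
    Matrix (Fin n) (Unit ⊕ Fin (n - 1)) ℝ :=
  Matrix.fromCols (Matrix.replicateCol Unit fun _ => 1 / Real.sqrt n) R

/-- `Q = [r, R]` is orthogonal and `ℒ = Q Λ Qᵀ` with `Λ = diag{0, λ₁, …, λₙ₋₁}`. -/
def IsReduction {n : ℕ} (G : SimpleGraph (Fin n)) [DecidableRel G.Adj]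
    (R : Matrix (Fin n) (Fin (n - 1)) ℝ) : Prop :=
  (extendCols R).transpose * extendCols R = 1 ∧ extendCols R * (extendCols R).transpose = 1 ∧
  ∃ ev : Fin (n - 1) → ℝ, G.lapMatrix ℝ =
    extendCols R * (Matrix.diagonal (Sum.elim (fun _ => 0) ev) :
      Matrix (Unit ⊕ Fin (n - 1)) (Unit ⊕ Fin (n - 1)) ℝ) * (extendCols R).transpose

/-! ### The original system, with states `(𝐳, 𝐲, 𝐱)` -/

/-- Solutions on the time interval `J` of
`𝐳' = -(∇f(𝐱) + 𝐋𝐱 + 𝐲)`, `𝐲' = 𝐋𝐱`, `𝐱 = ∇φ⋆(𝐳)`. -/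
def IsSolution {n d : ℕ} (𝒳 : Set (Vec d)) (f : Fin n → Vec d → ℝ) (φ : Vec d → ℝ)
    (G : SimpleGraph (Fin n)) [DecidableRel G.Adj]
    (J : Set ℝ) (p : ℝ → Stack n d × Stack n d × Stack n d) : Prop :=
  ∀ t ∈ J,
    HasDerivWithinAt (fun s => (p s).1)
      (-(gradStack 𝒳 f (p t).2.2 + act (bigLap d G) (p t).2.2 + (p t).2.1)) J t ∧
    HasDerivWithinAt (fun s => (p s).2.1) (act (bigLap d G) (p t).2.2) J t ∧
    (p t).2.2 = mirror 𝒳 φ (p t).1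

/-- The admissible states `(𝐳, 𝐲, 𝐱)`: `𝐱 = ∇φ⋆(𝐳)` and `y₁ + ⋯ + yₙ = 0`. The sum of the `yᵢ` is
constant along solutions, so this set is invariant; it contains every trajectory with
`𝐲(0) = 0`. -/
def admissible (n : ℕ) {d : ℕ} (𝒳 : Set (Vec d)) (φ : Vec d → ℝ) :
    Set (Stack n d × Stack n d × Stack n d) :=
  {p | ∑ i, block p.2.1 i = 0 ∧ p.2.2 = mirror 𝒳 φ p.1}

/-- The equilibrium `(𝐳⋆, 𝐲⋆, 𝐱⋆)`: `𝐱⋆ = 𝟙ₙ ⊗ x⋆`, `𝐲⋆ = -∇f(𝐱⋆)`, `𝐳⋆ = 𝟙ₙ ⊗ ∇φ(x⋆)`. -/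
def equilibrium {n d : ℕ} (𝒳 : Set (Vec d)) (f : Fin n → Vec d → ℝ) (φ : Vec d → ℝ)
    (xs : Vec d) : Stack n d × Stack n d × Stack n d :=
  (col fun _ => gradient φ xs, -gradStack 𝒳 f (col fun _ => xs), col fun _ => xs)

/-! ### The reduced system, with states `(x̃, W₂)` -/

/-- Solutions on the time interval `J` of
`x̃' = -∇²φ(x̃ + 𝐱⋆)⁻¹ (∇f(x̃ + 𝐱⋆) - ∇f(𝐱⋆) + 𝐋 x̃ + 𝐒 𝐑 W₂)`, `W₂' = 𝐑ᵀ 𝐒 x̃`,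
where `𝐑 = R ⊗ I_d`. -/
def IsReducedSolution {n d : ℕ} (𝒳 : Set (Vec d)) (f : Fin n → Vec d → ℝ) (φ : Vec d → ℝ)
    (G : SimpleGraph (Fin n)) [DecidableRel G.Adj] (R : Matrix (Fin n) (Fin (n - 1)) ℝ)
    (xs : Vec d) (J : Set ℝ) (p : ℝ → Stack n d × Stack (n - 1) d) : Prop :=
  ∀ t ∈ J,
    HasDerivWithinAt (fun s => (p s).1)
      (-(invHessianStack φ ((p t).1 + col fun _ => xs)
          (gradStack 𝒳 f ((p t).1 + col fun _ => xs) - gradStack 𝒳 f (col fun _ => xs)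
            + act (bigLap d G) (p t).1 + act (sqrtLap d G * kronId d R) (p t).2))) J t ∧
    HasDerivWithinAt (fun s => (p s).2)
      (act ((kronId d R).transpose * sqrtLap d G) (p t).1) J t

end DMD

end

/-! Both systems are treated by Lyapunov's indirect method: near an equilibrium a strictly
differentiable field is its linearization plus a perturbation with small Lipschitz constant, so a
quadratic form that decays strictly along the linearization still decays along the field
(`isLocallyExpStable_of_hasLyapunovForm`).

Both linearizations come from one saddle-point generator, `x' = -A (K x + D w)`, `w' = Dt x`, where
`Dt` is the adjoint of `D`. Here `H = A⁻¹` consists of copies of the Hessian of `φ` at the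
minimizer, and `K` is the Hessian of the costs plus the Laplacian. The energy `⟨H x, x⟩ + |w|²`
dissipates only through `x`; a small cross term `2ε⟨H x, D w⟩` adds dissipation of `|D w|²`, which
controls `w` when `D` is injective (`hasLyapunovForm_saddleGen`). The system in `z` is carried to
the one in `x` by `x = A z`.

Two facts make the hypotheses hold. First, `K` is coercive although single costs may be degenerate:
the Laplacian form vanishes only on consensus vectors, where the cost Hessians add up to that of the
strongly convex sum (`exists_coercive_blockDiag_add_bigLap`). Second, the square root of the
Laplacian is invertible on vectors whose blocks sum to zero. In (a) this permits the substitution `y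
= y⋆ + S w`, which removes the conserved direction; in (b) it makes `S R` injective.

The mirror map is handled by the inverse function theorem: near `∇φ(x⋆)` the gradient of the
conjugate is the local inverse of `∇φ` (`hasStrictFDerivAt_gradient_conjugate`). -/

namespace DMD

/-! ### Lyapunov's indirect method for autonomous equations -/

section ODE

variable {E : Type*} [NormedAddCommGroup E]

/-- Scaling factor of the radial retraction onto the closed ball of radius `r`. -/
noncomputable def retractFactor (r : ℝ) (u : E) : ℝ := min 1 (r / ‖u‖)

theorem retractFactor_nonneg {r : ℝ} (hr : 0 ≤ r) (u : E) : 0 ≤ retractFactor r u :=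
  le_min zero_le_one (by positivity)

/-- The origin is excluded because `r / 0 = 0` makes the factor vanish there; the retraction itself
is unaffected. -/
theorem retractFactor_pos {r : ℝ} (hr : 0 < r) {u : E} (hu : u ≠ 0) : 0 < retractFactor r u :=
  lt_min one_pos (div_pos hr (norm_pos_iff.2 hu))

theorem retractFactor_mul_norm {r : ℝ} (hr : 0 ≤ r) (u : E) :
    retractFactor r u * ‖u‖ = min ‖u‖ r := by
  rcases eq_or_ne u 0 with rfl | hu
  · simp [hr]
  · have : 0 < ‖u‖ := norm_pos_iff.2 hu
    rw [retractFactor, min_mul_of_nonneg _ _ this.le, one_mul, div_mul_cancel₀ _ this.ne']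

variable [NormedSpace ℝ E]

/-- Solutions of the autonomous equation `p' = g p` on the time interval `J`. -/
def IsODESol (g : E → E) (J : Set ℝ) (p : ℝ → E) : Prop :=
  ∀ t ∈ J, HasDerivWithinAt p (g (p t)) J t

theorem IsODESol.continuousOn {g : E → E} {J : Set ℝ} {p : ℝ → E} (h : IsODESol g J p) :
    ContinuousOn p J := fun t ht => (h t ht).continuousWithinAt

theorem IsODESol.mono {g : E → E} {J J' : Set ℝ} {p : ℝ → E} (h : IsODESol g J p) (hJ : J' ⊆ J) :
    IsODESol g J' p := fun t ht => (h t (hJ ht)).mono hJ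

theorem hasDerivWithinAt_Ici_of_Icc {p : ℝ → E} {v : E} {a b t : ℝ} (ht : t ∈ Set.Ico a b)
    (h : HasDerivWithinAt p v (Set.Icc a b) t) : HasDerivWithinAt p v (Set.Ici t) t := by
  have h1 : HasDerivWithinAt p v (Set.Icc t b) t := h.mono (Set.Icc_subset_Icc_left ht.1)
  exact h1.mono_of_mem_nhdsWithin (Icc_mem_nhdsGE ht.2)

/-- The radial retraction onto the closed ball of radius `r`. -/
noncomputable def ballRetract (r : ℝ) (u : E) : E := retractFactor r u • u

theorem norm_ballRetract {r : ℝ} (hr : 0 ≤ r) (u : E) : ‖ballRetract r u‖ = min ‖u‖ r := by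
  rw [ballRetract, norm_smul, Real.norm_of_nonneg (retractFactor_nonneg hr u),
    retractFactor_mul_norm hr]

theorem ballRetract_of_norm_le {r : ℝ} {u : E} (hu : ‖u‖ ≤ r) : ballRetract r u = u := by
  rcases eq_or_ne u 0 with rfl | h0
  · simp [ballRetract]
  · have : 0 < ‖u‖ := norm_pos_iff.2 h0
    rw [ballRetract, retractFactor, min_eq_left ((one_le_div this).2 hu), one_smul]

/-- The state spaces carry the max norm of a product, so nonexpansiveness of Hilbert space
projections is not at hand. With `‖v‖ ≤ ‖u‖` the difference splits into the scaled `u - v` and a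
change of scale applied to `v`, each of norm at most `‖u - v‖`. -/
theorem lipschitzWith_ballRetract {r : ℝ} (hr : 0 ≤ r) :
    LipschitzWith 2 (ballRetract r : E → E) := by
  have key : ∀ u v : E, ‖v‖ ≤ ‖u‖ → ‖ballRetract r u - ballRetract r v‖ ≤ 2 * ‖u - v‖ := by
    intro u v huv
    have hs0 := retractFactor_nonneg hr u
    have hs1 : retractFactor r u ≤ 1 := min_le_left _ _
    have hsu := retractFactor_mul_norm hr u
    have htv := retractFactor_mul_norm hr v
    have hmin : min ‖v‖ r ≤ min ‖u‖ r := min_le_min_right r huv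
    have hsv : retractFactor r u * ‖v‖ ≤ min ‖v‖ r := by
      refine le_min (mul_le_of_le_one_left (norm_nonneg _) hs1) ?_
      calc retractFactor r u * ‖v‖ ≤ retractFactor r u * ‖u‖ := by gcongr
        _ ≤ r := hsu.trans_le (min_le_right _ _)
    have hdecomp : ballRetract r u - ballRetract r v =
        retractFactor r u • (u - v) + (retractFactor r u - retractFactor r v) • v := by
      simp only [ballRetract]; module
    have htri : ‖u‖ - ‖v‖ ≤ ‖u - v‖ := norm_sub_norm_le u v
    have h1 : |retractFactor r u - retractFactor r v| * ‖v‖ ≤ ‖u - v‖ := by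
      rw [show |retractFactor r u - retractFactor r v| * ‖v‖ =
          |(retractFactor r u - retractFactor r v) * ‖v‖| by rw [abs_mul, abs_norm], sub_mul, htv,
        abs_sub_comm, abs_of_nonneg (by linarith)]
      calc min ‖v‖ r - retractFactor r u * ‖v‖
          ≤ retractFactor r u * (‖u‖ - ‖v‖) := by rw [mul_sub, hsu]; linarith
        _ ≤ retractFactor r u * ‖u - v‖ := by gcongr
        _ ≤ ‖u - v‖ := mul_le_of_le_one_left (norm_nonneg _) hs1
    have h2 : ‖retractFactor r u • (u - v)‖ ≤ ‖u - v‖ := by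
      rw [norm_smul, Real.norm_of_nonneg hs0]
      exact mul_le_of_le_one_left (norm_nonneg _) hs1
    have h3 : ‖(retractFactor r u - retractFactor r v) • v‖ ≤ ‖u - v‖ := by
      rw [norm_smul, Real.norm_eq_abs]; exact h1
    calc ‖ballRetract r u - ballRetract r v‖ ≤ ‖u - v‖ + ‖u - v‖ := by
          rw [hdecomp]; exact (norm_add_le _ _).trans (add_le_add h2 h3)
      _ = 2 * ‖u - v‖ := by ring
  refine LipschitzWith.of_dist_le_mul fun u v => ?_
  rw [dist_eq_norm, dist_eq_norm]
  rcases le_total ‖v‖ ‖u‖ with h | h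
  · exact key u v h
  · rw [norm_sub_rev, norm_sub_rev u]; exact key v u h

/-- A bounded Lipschitz vector field has solutions on `[0, ∞)`. -/
theorem exists_isODESol_Ici [CompleteSpace E] {g : E → E} {K : NNReal} (hK : LipschitzWith K g)
    {B : NNReal} (hB : ∀ u, ‖g u‖ ≤ B) (p₀ : E) :
    ∃ p : ℝ → E, p 0 = p₀ ∧ IsODESol g (Set.Ici 0) p := by
  have hloc : ∀ N : ℕ, ∃ p : ℝ → E, p 0 = p₀ ∧ IsODESol g (Set.Icc 0 (N : ℝ)) p := by
    intro N
    -- A field bounded by `B` moves a point by at most `B * N` in time `N`, so a ball of this radius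
    -- imposes no restriction on the time interval.
    have hpl : IsPicardLindelof (fun _ => g) (tmin := 0) (tmax := N)
        ⟨0, Set.left_mem_Icc.2 N.cast_nonneg⟩ p₀ (B * N) 0 B K :=
      { lipschitzOnWith := fun _ _ => hK.lipschitzOnWith
        continuousOn := fun _ _ => continuousOn_const
        norm_le := fun _ _ u _ => hB u
        mul_max_le := by simp }
    exact hpl.exists_eq_forall_mem_Icc_hasDerivWithinAt₀
  choose p hp0 hp using hloc
  have hagree : ∀ M N : ℕ, M ≤ N → Set.EqOn (p M) (p N) (Set.Icc 0 (M : ℝ)) := by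
    intro M N hMN
    have hsub : Set.Icc (0 : ℝ) M ⊆ Set.Icc 0 N := Set.Icc_subset_Icc_right (by exact_mod_cast hMN)
    exact ODE_solution_unique (v := fun _ => g) (fun _ => hK) (hp M).continuousOn
      (fun t ht => hasDerivWithinAt_Ici_of_Icc ht (hp M t (Set.Ico_subset_Icc_self ht)))
      ((hp N).continuousOn.mono hsub)
      (fun t ht => hasDerivWithinAt_Ici_of_Icc ht
        ((hp N).mono hsub t (Set.Ico_subset_Icc_self ht))) ((hp0 M).trans (hp0 N).symm)
  have heq : ∀ (N : ℕ) (t : ℝ), t ∈ Set.Icc (0 : ℝ) N → p ⌈t⌉₊ t = p N t := fun N t ht =>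
    hagree _ N (Nat.ceil_le.2 ht.2) ⟨ht.1, Nat.le_ceil t⟩
  refine ⟨fun t => p ⌈t⌉₊ t, by simp [hp0], fun t ht => ?_⟩
  obtain ⟨N, hN⟩ := exists_nat_gt t
  have ht' : t ∈ Set.Icc (0 : ℝ) N := ⟨ht, hN.le⟩
  have h1 : HasDerivWithinAt (p N) (g (p N t)) (Set.Icc 0 (N : ℝ)) t := hp N t ht'
  have h2 : HasDerivWithinAt (fun t => p ⌈t⌉₊ t) (g (p ⌈t⌉₊ t)) (Set.Icc 0 (N : ℝ)) t := by
    rw [heq N t ht']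
    exact h1.congr (fun s hs => heq N s hs) (heq N t ht')
  refine h2.mono_of_mem_nhdsWithin ?_
  rw [← Set.Ici_inter_Iic]
  exact Filter.inter_mem self_mem_nhdsWithin (mem_nhdsWithin_of_mem_nhds (Iic_mem_nhds hN))

/-- Two solutions with the same initial value agree as long as one of them stays in an open ball
on which the vector field is Lipschitz. -/
theorem IsODESol.eqOn_of_mem_ball {g : E → E} {K : NNReal} {r T : ℝ}
    (hK : LipschitzOnWith K g (Metric.ball 0 r)) {p q : ℝ → E}
    (hp : IsODESol g (Set.Icc 0 T) p) (hq : IsODESol g (Set.Icc 0 T) q) (h0 : q 0 = p 0)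
    (hr : ∀ t ∈ Set.Icc 0 T, p t ∈ Metric.ball 0 r) : Set.EqOn q p (Set.Icc 0 T) := by
  have hclosed : IsClosed ({t | q t = p t} ∩ Set.Icc 0 T) := by
    have h := (hq.continuousOn.sub hp.continuousOn).preimage_isClosed_of_isClosed isClosed_Icc
      (isClosed_singleton (x := (0 : E)))
    convert h using 1
    ext t
    simp [sub_eq_zero, and_comm]
  -- Only `p` is known to stay in the ball. At a time of coincidence, continuity keeps `q` in the
  -- open ball a little longer, and local uniqueness extends the coincidence; closedness then
  -- propagates it to all of `[0, T]`.
  refine fun t ht => hclosed.Icc_subset_of_forall_mem_nhdsWithin h0 ?_ ht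
  rintro x ⟨hx, hx0⟩
  have hxI := Set.Ico_subset_Icc_self hx0
  have hball : Metric.ball (0 : E) r ∈ 𝓝 (p x) := Metric.isOpen_ball.mem_nhds (hr x hxI)
  have hqev : ∀ᶠ s in 𝓝[Set.Icc 0 T] x, q s ∈ Metric.ball (0 : E) r :=
    hq.continuousOn x hxI (by rw [show q x = p x from hx]; exact hball)
  have hle : 𝓝[≥] x ≤ 𝓝[Set.Icc 0 T] x := by
    rw [← nhdsWithin_Icc_eq_nhdsGE hx0.2]
    exact nhdsWithin_mono _ (Set.Icc_subset_Icc_left hx0.1)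
  obtain ⟨b, hb, hbs⟩ := (mem_nhdsGE_iff_exists_Icc_subset).1
    (Filter.inter_mem (hle hqev) (Icc_mem_nhdsGE hx0.2))
  have hsub : Set.Icc x b ⊆ Set.Icc 0 T := fun s hs =>
    ⟨hx0.1.trans hs.1, (hbs hs).2.2⟩
  have heq : Set.EqOn q p (Set.Icc x b) :=
    ODE_solution_unique_of_mem_Icc_right (v := fun _ => g) (s := fun _ => Metric.ball 0 r)
      (fun _ _ => hK) (hq.continuousOn.mono hsub)
      (fun t ht => hasDerivWithinAt_Ici_of_Icc ht (hq.mono hsub t (Set.Ico_subset_Icc_self ht)))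
      (fun t ht => (hbs (Set.Ico_subset_Icc_self ht)).1) (hp.continuousOn.mono hsub)
      (fun t ht => hasDerivWithinAt_Ici_of_Icc ht (hp.mono hsub t (Set.Ico_subset_Icc_self ht)))
      (fun t ht => hr t (hsub (Set.Ico_subset_Icc_self ht))) hx
  exact Filter.mem_of_superset (Ioc_mem_nhdsGT hb) fun s hs => heq (Set.Ioc_subset_Icc_self hs)

theorem le_initial_of_hasDerivWithinAt_nonpos {V V' : ℝ → ℝ}
    (hV : ∀ t, 0 ≤ t → HasDerivWithinAt V (V' t) (Set.Ici 0) t) (hV' : ∀ t, 0 ≤ t → V' t ≤ 0)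
    {t : ℝ} (ht : 0 ≤ t) : V t ≤ V 0 := by
  refine (antitoneOn_of_hasDerivWithinAt_nonpos (f' := V') (convex_Ici 0)
    (fun s hs => (hV s hs).continuousWithinAt) (fun s hs => ?_) (fun s hs => ?_))
    Set.self_mem_Ici ht ht
  · exact (hV s (interior_subset hs)).mono interior_subset
  · exact hV' s (interior_subset hs)

/-- A quadratic Lyapunov form for the linear system `u' = M u`. -/
def HasLyapunovForm (M : E →L[ℝ] E) : Prop :=
  ∃ P : E →L[ℝ] E →L[ℝ] ℝ, (∀ u v, P u v = P v u) ∧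
    (∃ a > 0, ∀ u, a * ‖u‖ ^ 2 ≤ P u u) ∧ ∃ c > 0, ∀ u, P u (M u) ≤ -(c * ‖u‖ ^ 2)

theorem hasDerivWithinAt_quadratic {P : E →L[ℝ] E →L[ℝ] ℝ} (hP : ∀ u v, P u v = P v u)
    {p : ℝ → E} {v : E} {J : Set ℝ} {t : ℝ} (h : HasDerivWithinAt p v J t) :
    HasDerivWithinAt (fun s => P (p s) (p s)) (2 * P (p t) v) J t := by
  have h1 : HasDerivWithinAt (fun s => P (p s)) (P v) J t :=
    P.hasFDerivAt.comp_hasDerivWithinAt t h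
  have h2 := h1.clm_apply h
  rwa [hP v, ← two_mul] at h2

/-- **Lyapunov's indirect method.** An equilibrium is locally exponentially stable if the
linearization there has a quadratic Lyapunov form. -/
theorem isLocallyExpStable_of_hasLyapunovForm [CompleteSpace E] {g : E → E} {M : E →L[ℝ] E}
    (hg0 : g 0 = 0) (hg : HasStrictFDerivAt g M 0) (hM : HasLyapunovForm M) :
    IsLocallyExpStable (IsODESol g) Set.univ 0 := by
  obtain ⟨P, hPs, ⟨a, ha, hPa⟩, c, hc, hPc⟩ := hM
  obtain ⟨B, hB, hPB⟩ : ∃ B > 0, ∀ u v, |P u v| ≤ B * ‖u‖ * ‖v‖ :=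
    ⟨‖P‖ + 1, by positivity, fun u v => by
      have := P.le_opNorm₂ u v
      rw [Real.norm_eq_abs] at this
      refine this.trans ?_
      gcongr
      linarith⟩
  -- With this Lipschitz constant for `g - M`, the perturbation costs at most `c / 2 * ‖u‖ ^ 2`,
  -- half of the linear decay.
  obtain ⟨η, hη⟩ : ∃ η : NNReal, (η : ℝ) = c / (2 * B) := ⟨⟨c / (2 * B), by positivity⟩, rfl⟩
  obtain ⟨s, hs, hgs⟩ := hg.approximates_deriv_on_nhds (c := η)
    (Or.inr (by rw [← NNReal.coe_pos, hη]; positivity))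
  obtain ⟨r, hr, hrs⟩ := Metric.nhds_basis_closedBall.mem_iff.1 hs
  obtain ⟨K, hgK⟩ : ∃ K, LipschitzOnWith K g (Metric.closedBall 0 r) :=
    ⟨_, lipschitzOnWith_iff_restrict.2 (hgs.mono_set hrs).lipschitz⟩
  have hdecay : ∀ u : E, ‖u‖ ≤ r → P u (g u) ≤ -(c / 2 * ‖u‖ ^ 2) := by
    intro u hu
    have h1 : ‖g u - M u‖ ≤ c / (2 * B) * ‖u‖ := by
      have := hgs u (hrs (by simpa using hu)) 0 (mem_of_mem_nhds hs)
      simpa [hg0, hη] using this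
    have h2 : P u (g u) = P u (M u) + P u (g u - M u) := by rw [map_sub]; ring
    have h3 : P u (g u - M u) ≤ B * ‖u‖ * (c / (2 * B) * ‖u‖) :=
      (le_abs_self _).trans ((hPB _ _).trans (by gcongr))
    have h4 : B * ‖u‖ * (c / (2 * B) * ‖u‖) = c / 2 * ‖u‖ ^ 2 := by field_simp
    rw [h2]
    linarith [hPc u]
  -- Composing `g` with the retraction gives a bounded, globally Lipschitz field, hence a global
  -- solution. The retracted point is a positive multiple of `u` off the origin, so the form is
  -- nonincreasing along the cut-off field everywhere; the solution therefore stays where the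
  -- cut-off is inactive.
  have hmem : ∀ u : E, ballRetract r u ∈ Metric.closedBall (0 : E) r := fun u => by
    rw [mem_closedBall_zero_iff, norm_ballRetract hr.le]; exact min_le_right _ _
  have hcutLip : LipschitzWith (K * 2) (fun u => g (ballRetract r u)) := by
    have h := hgK.comp ((lipschitzWith_ballRetract (E := E) hr.le).lipschitzOnWith (s := Set.univ))
      (fun u _ => hmem u)
    exact lipschitzOnWith_univ.1 h
  have hcutB : ∀ u : E, ‖g (ballRetract r u)‖ ≤ (K * ⟨r, hr.le⟩ : NNReal) := fun u => by
    have h := hgK.dist_le_mul _ (hmem u) 0 (by simp [hr.le])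
    rw [hg0, dist_zero_right, dist_zero_right] at h
    exact h.trans (by
      exact mul_le_mul_of_nonneg_left (mem_closedBall_zero_iff.1 (hmem u)) K.2)
  have hcutV : ∀ u : E, P u (g (ballRetract r u)) ≤ 0 := by
    intro u
    rcases eq_or_ne u 0 with rfl | hu
    · simp
    · have hs := retractFactor_pos hr hu
      have h1 := hdecay (ballRetract r u) (mem_closedBall_zero_iff.1 (hmem u))
      have h2 : P (ballRetract r u) (g (ballRetract r u)) =
          retractFactor r u * P u (g (ballRetract r u)) := by
        conv_lhs => rw [show ballRetract r u = retractFactor r u • u from rfl]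
        simp [ballRetract]
      rw [h2] at h1
      have h3 : retractFactor r u * P u (g (ballRetract r u)) ≤ 0 :=
        h1.trans (neg_nonpos.2 (by positivity))
      exact nonpos_of_mul_nonpos_right h3 hs
  -- From `a‖u‖² ≤ P u u ≤ B‖u‖²`, a start within `r / 2 * √(a / B)` stays within `r / 2`. The form
  -- decays at rate `c / B`, so the norm decays at half that rate with factor `√(B / a)`.
  refine ⟨Set.mem_univ _, fun t _ => by simpa [hg0] using hasDerivWithinAt_const t _ (0 : E),
    r / 2 * √(a / B), by positivity, √(B / a), by positivity, c / B / 2, by positivity,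
    fun p₀ _ hp₀ => ?_⟩
  rw [sub_zero] at hp₀
  obtain ⟨p, hp0, hpcut⟩ := exists_isODESol_Ici hcutLip hcutB p₀
  have hPp₀ : P p₀ p₀ ≤ B * ‖p₀‖ ^ 2 :=
    (le_abs_self _).trans ((hPB _ _).trans_eq (by ring))
  have hball : ∀ t, 0 ≤ t → ‖p t‖ ≤ r / 2 := by
    intro t ht
    have hV := le_initial_of_hasDerivWithinAt_nonpos (V := fun s => P (p s) (p s))
      (fun t ht => hasDerivWithinAt_quadratic hPs (hpcut t ht))
      (fun t _ => by linarith [hcutV (p t)]) ht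
    simp only [hp0] at hV
    have h1 : a * ‖p t‖ ^ 2 ≤ B * (r / 2 * √(a / B)) ^ 2 :=
      (hPa _).trans (hV.trans (hPp₀.trans (by gcongr)))
    have h2 : B * (r / 2 * √(a / B)) ^ 2 = a * (r / 2) ^ 2 := by
      rw [mul_pow, Real.sq_sqrt (by positivity)]; field_simp
    rw [h2] at h1
    exact le_of_abs_le (abs_le_of_sq_le_sq (le_of_mul_le_mul_left h1 ha) (by positivity))
  have hp : IsODESol g (Set.Ici 0) p := fun t ht => by
    have h := hpcut t ht
    simp only [ballRetract_of_norm_le ((hball t ht).trans (half_le_self hr.le))] at h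
    exact h
  refine ⟨p, hp0, hp, fun t ht => ?_, fun T hT q hq0 hq => ?_⟩
  · have hV := le_initial_of_hasDerivWithinAt_nonpos
      (V := fun s => Real.exp (c / B * s) * P (p s) (p s))
      (V' := fun s => Real.exp (c / B * s) * (c / B) * P (p s) (p s) +
        Real.exp (c / B * s) * (2 * P (p s) (g (p s))))
      (fun t ht => by
        have h1 : HasDerivWithinAt (fun s => Real.exp (c / B * s))
            (Real.exp (c / B * t) * (c / B)) (Set.Ici 0) t := by
          simpa using ((hasDerivAt_id t).const_mul (c / B)).exp.hasDerivWithinAt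
        exact h1.mul (hasDerivWithinAt_quadratic hPs (hp t ht)))
      (fun t ht => by
        have h1 := hdecay (p t) ((hball t ht).trans (by linarith))
        have h2 : P (p t) (p t) ≤ B * ‖p t‖ ^ 2 :=
          (le_abs_self _).trans ((hPB _ _).trans_eq (by ring))
        have h3 : c / B * P (p t) (p t) ≤ c * ‖p t‖ ^ 2 := by
          calc c / B * P (p t) (p t) ≤ c / B * (B * ‖p t‖ ^ 2) := by gcongr
            _ = c * ‖p t‖ ^ 2 := by field_simp
        have h4 := Real.exp_pos (c / B * t)
        rw [mul_assoc, ← mul_add]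
        exact mul_nonpos_of_nonneg_of_nonpos h4.le (by linarith)) ht
    simp only [hp0, mul_zero, Real.exp_zero, one_mul] at hV
    simp only [sub_zero]
    have h1 : ‖p t‖ ^ 2 ≤ (√(B / a) * ‖p₀‖ * Real.exp (-(c / B / 2) * t)) ^ 2 := by
      have h2 : Real.exp (-(c / B / 2) * t) ^ 2 * Real.exp (c / B * t) = 1 := by
        rw [sq, ← Real.exp_add, ← Real.exp_add]
        convert Real.exp_zero using 2
        ring
      have h3 : a * ‖p t‖ ^ 2 ≤ P (p t) (p t) := hPa _
      have h4 : P (p t) (p t) ≤ Real.exp (-(c / B / 2) * t) ^ 2 * (B * ‖p₀‖ ^ 2) := by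
        calc P (p t) (p t) = Real.exp (-(c / B / 2) * t) ^ 2 *
              (Real.exp (c / B * t) * P (p t) (p t)) := by rw [← mul_assoc, h2, one_mul]
          _ ≤ _ := mul_le_mul_of_nonneg_left (hV.trans hPp₀) (sq_nonneg _)
      rw [mul_pow, mul_pow, Real.sq_sqrt (by positivity)]
      have h5 : B / a * ‖p₀‖ ^ 2 * Real.exp (-(c / B / 2) * t) ^ 2 =
          (Real.exp (-(c / B / 2) * t) ^ 2 * (B * ‖p₀‖ ^ 2)) / a := by ring
      rw [h5, le_div_iff₀ ha]
      linarith
    exact le_of_abs_le (abs_le_of_sq_le_sq h1 (by positivity))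
  · refine IsODESol.eqOn_of_mem_ball (r := r) (hgK.mono Metric.ball_subset_closedBall)
      (hp.mono Set.Icc_subset_Ici_self) hq (hq0.trans hp0.symm) fun t ht => ?_
    rw [mem_ball_zero_iff]
    linarith [hball t ht.1]

end ODE

/-! ### Quadratic Lyapunov forms for saddle-point generators -/

section Saddle

/-- The form is pulled back along `T`; the lower bound on `T` preserves its coercivity and its
strict decay. -/
theorem HasLyapunovForm.of_semiconj {E E' : Type*} [NormedAddCommGroup E] [NormedSpace ℝ E]
    [NormedAddCommGroup E'] [NormedSpace ℝ E'] {M : E →L[ℝ] E} {M' : E' →L[ℝ] E'}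
    (hM : HasLyapunovForm M) (T : E' →L[ℝ] E) (hT : ∀ u, T (M' u) = M (T u)) {b : ℝ} (hb : 0 < b)
    (hTb : ∀ u, b * ‖u‖ ≤ ‖T u‖) : HasLyapunovForm M' := by
  obtain ⟨P, hPs, ⟨a, ha, hPa⟩, c, hc, hPc⟩ := hM
  have hsq : ∀ u, b ^ 2 * ‖u‖ ^ 2 ≤ ‖T u‖ ^ 2 := fun u => by
    rw [← mul_pow]; gcongr; exact hTb u
  refine ⟨P.bilinearComp T T, fun u v => hPs _ _, ⟨a * b ^ 2, by positivity, fun u => ?_⟩,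
    c * b ^ 2, by positivity, fun u => ?_⟩
  · rw [mul_assoc]
    exact (mul_le_mul_of_nonneg_left (hsq u) ha.le).trans (hPa (T u))
  · rw [ContinuousLinearMap.bilinearComp_apply, hT, mul_assoc]
    exact (hPc (T u)).trans (neg_le_neg (mul_le_mul_of_nonneg_left (hsq u) hc.le))

theorem norm_sq_prod_le {U W : Type*} [NormedAddCommGroup U] [NormedAddCommGroup W]
    (u : U × W) : ‖u‖ ^ 2 ≤ ‖u.1‖ ^ 2 + ‖u.2‖ ^ 2 := by
  rw [Prod.norm_def]
  rcases max_cases ‖u.1‖ ‖u.2‖ with ⟨h, -⟩ | ⟨h, -⟩ <;> rw [h] <;>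
    nlinarith [norm_nonneg u.1, norm_nonneg u.2]

variable {U W : Type*} [NormedAddCommGroup U] [InnerProductSpace ℝ U] [NormedAddCommGroup W]
  [InnerProductSpace ℝ W]

/-- The generator of `x' = -A (K x + D w)`, `w' = Dt x`. -/
noncomputable def saddleGen (A K : U →L[ℝ] U) (D : W →L[ℝ] U) (Dt : U →L[ℝ] W) :
    U × W →L[ℝ] U × W :=
  (-(A ∘L (K ∘L ContinuousLinearMap.fst ℝ U W + D ∘L ContinuousLinearMap.snd ℝ U W))).prod
    (Dt ∘L ContinuousLinearMap.fst ℝ U W)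

/-- The generator of `z' = -(K A z + D w)`, `w' = Dt A z`. -/
noncomputable def dualSaddleGen (A K : U →L[ℝ] U) (D : W →L[ℝ] U) (Dt : U →L[ℝ] W) :
    U × W →L[ℝ] U × W :=
  (-(K ∘L A ∘L ContinuousLinearMap.fst ℝ U W + D ∘L ContinuousLinearMap.snd ℝ U W)).prod
    (Dt ∘L A ∘L ContinuousLinearMap.fst ℝ U W)

/-- The quadratic form `⟨H x, x⟩ + |w|² + 2 ε ⟨H x, D w⟩`. -/
noncomputable def saddleForm (H : U →L[ℝ] U) (D : W →L[ℝ] U) (ε : ℝ) :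
    U × W →L[ℝ] U × W →L[ℝ] ℝ :=
  let x := ContinuousLinearMap.fst ℝ U W
  let w := ContinuousLinearMap.snd ℝ U W
  let B : U →L[ℝ] U →L[ℝ] ℝ := innerSL ℝ
  let C : W →L[ℝ] W →L[ℝ] ℝ := innerSL ℝ
  B.bilinearComp (H ∘L x) x + C.bilinearComp w w +
    ε • (B.bilinearComp (H ∘L x) (D ∘L w) + B.bilinearComp (D ∘L w) (H ∘L x))

theorem saddleForm_apply (H : U →L[ℝ] U) (D : W →L[ℝ] U) (ε : ℝ) (u v : U × W) :
    saddleForm H D ε u v = ⟪H u.1, v.1⟫_ℝ + ⟪u.2, v.2⟫_ℝ +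
      ε * (⟪H u.1, D v.2⟫_ℝ + ⟪D u.2, H v.1⟫_ℝ) := rfl

/-- In the plain energy the coupling terms cancel because `Dt` is adjoint to `D`, leaving `-⟨K x,
x⟩`. Since `H A = 1`, the cross term contributes `-ε‖D w‖²` and errors which Young's inequality
absorbs for small `ε`. -/
theorem hasLyapunovForm_saddleGen {H A K : U →L[ℝ] U} {D : W →L[ℝ] U} {Dt : U →L[ℝ] W}
    (hHA : ∀ x, H (A x) = x) (hH : ∀ x y, ⟪H x, y⟫_ℝ = ⟪x, H y⟫_ℝ)
    {μ : ℝ} (hμ : 0 < μ) (hHμ : ∀ x, μ * ‖x‖ ^ 2 ≤ ⟪H x, x⟫_ℝ)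
    {κ : ℝ} (hκ : 0 < κ) (hKκ : ∀ x, κ * ‖x‖ ^ 2 ≤ ⟪K x, x⟫_ℝ)
    {σ : ℝ} (hσ : 0 < σ) (hDσ : ∀ w, σ * ‖w‖ ^ 2 ≤ ‖D w‖ ^ 2)
    (hD : ∀ x w, ⟪Dt x, w⟫_ℝ = ⟪x, D w⟫_ℝ) : HasLyapunovForm (saddleGen A K D Dt) := by
  obtain ⟨b₁, hb₁, hB₁⟩ : ∃ b₁ : ℝ, 0 < b₁ ∧ ∀ x, ⟪H x, D (Dt x)⟫_ℝ ≤ b₁ * ‖x‖ ^ 2 :=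
    ⟨‖H‖ * ‖D ∘L Dt‖ + 1, by positivity, fun x => by
      have h : ⟪H x, D (Dt x)⟫_ℝ ≤ (‖H‖ * ‖x‖) * (‖D ∘L Dt‖ * ‖x‖) :=
        (real_inner_le_norm _ _).trans (mul_le_mul (H.le_opNorm x) ((D ∘L Dt).le_opNorm x)
          (norm_nonneg _) (by positivity))
      nlinarith [sq_nonneg ‖x‖]⟩
  obtain ⟨b₂, hb₂, hB₂⟩ : ∃ b₂ : ℝ, 0 < b₂ ∧ ∀ x w, -⟪K x, D w⟫_ℝ ≤ b₂ * ‖x‖ * ‖D w‖ :=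
    ⟨‖K‖ + 1, by positivity, fun x w => by
      have h1 : -⟪K x, D w⟫_ℝ ≤ ‖K x‖ * ‖D w‖ :=
        (neg_le_abs _).trans (abs_real_inner_le_norm _ _)
      refine h1.trans (mul_le_mul_of_nonneg_right ((K.le_opNorm x).trans ?_) (norm_nonneg _))
      nlinarith [norm_nonneg x]⟩
  obtain ⟨b₃, hb₃, hB₃⟩ : ∃ b₃ : ℝ, 0 < b₃ ∧ ∀ x w, -⟪H x, D w⟫_ℝ ≤ b₃ * (‖x‖ * ‖w‖) :=
    ⟨‖H‖ * ‖D‖ + 1, by positivity, fun x w => by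
      have h1 : -⟪H x, D w⟫_ℝ ≤ ‖H x‖ * ‖D w‖ :=
        (neg_le_abs _).trans (abs_real_inner_le_norm _ _)
      have h2 : ‖H x‖ * ‖D w‖ ≤ (‖H‖ * ‖x‖) * (‖D‖ * ‖w‖) :=
        mul_le_mul (H.le_opNorm x) (D.le_opNorm w) (norm_nonneg _) (by positivity)
      have h3 : 0 ≤ ‖x‖ * ‖w‖ := by positivity
      nlinarith⟩
  -- The first bound lets half of `κ` absorb the errors in `x`; the other two keep the form positive
  -- definite despite the cross term.
  obtain ⟨ε, hε, hε₁, hε₂, hε₃⟩ : ∃ ε : ℝ, 0 < ε ∧ ε * (b₁ + b₂ ^ 2 / 2) ≤ κ / 2 ∧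
      ε * b₃ ≤ μ / 2 ∧ ε * b₃ ≤ 1 / 2 := by
    refine ⟨min (κ / 2 / (b₁ + b₂ ^ 2 / 2)) (min (μ / 2 / b₃) (1 / 2 / b₃)), by positivity,
      ?_, ?_, ?_⟩
    · rw [← le_div_iff₀ (by positivity)]; exact min_le_left _ _
    · rw [← le_div_iff₀ (by positivity)]; exact (min_le_right _ _).trans (min_le_left _ _)
    · rw [← le_div_iff₀ (by positivity)]; exact (min_le_right _ _).trans (min_le_right _ _)
  refine ⟨saddleForm H D ε, fun u v => ?_, ⟨min (μ / 2) (1 / 2), by positivity, fun u => ?_⟩,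
    min (κ / 2) (ε * σ / 2), by positivity, fun u => ?_⟩
  · rw [saddleForm_apply, saddleForm_apply, hH, real_inner_comm u.1, real_inner_comm v.2,
      real_inner_comm (H u.1) (D v.2), real_inner_comm (D u.2) (H v.1)]
    ring
  · obtain ⟨x, w⟩ := u
    rw [saddleForm_apply, real_inner_self_eq_norm_sq, real_inner_comm (H x) (D w)]
    have h1 := norm_sq_prod_le (x, w)
    have h2 := hHμ x
    have h3 : ε * -⟪H x, D w⟫_ℝ ≤ ε * (b₃ * (‖x‖ * ‖w‖)) :=
      mul_le_mul_of_nonneg_left (hB₃ x w) hε.le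
    have h4 : 2 * (‖x‖ * ‖w‖) ≤ ‖x‖ ^ 2 + ‖w‖ ^ 2 := by nlinarith [sq_nonneg (‖x‖ - ‖w‖)]
    have h5 : ε * b₃ * (2 * (‖x‖ * ‖w‖)) ≤ ε * b₃ * (‖x‖ ^ 2 + ‖w‖ ^ 2) :=
      mul_le_mul_of_nonneg_left h4 (by positivity)
    have h6 : ε * b₃ * ‖x‖ ^ 2 ≤ μ / 2 * ‖x‖ ^ 2 := mul_le_mul_of_nonneg_right hε₂ (sq_nonneg _)
    have h7 : ε * b₃ * ‖w‖ ^ 2 ≤ 1 / 2 * ‖w‖ ^ 2 := mul_le_mul_of_nonneg_right hε₃ (sq_nonneg _)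
    have h8 : min (μ / 2) (1 / 2) * ‖(x, w)‖ ^ 2 ≤ min (μ / 2) (1 / 2) * (‖x‖ ^ 2 + ‖w‖ ^ 2) :=
      mul_le_mul_of_nonneg_left h1 (by positivity)
    have h9 : min (μ / 2) (1 / 2) * ‖x‖ ^ 2 ≤ μ / 2 * ‖x‖ ^ 2 :=
      mul_le_mul_of_nonneg_right (min_le_left _ _) (sq_nonneg _)
    have h10 : min (μ / 2) (1 / 2) * ‖w‖ ^ 2 ≤ 1 / 2 * ‖w‖ ^ 2 :=
      mul_le_mul_of_nonneg_right (min_le_right _ _) (sq_nonneg _)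
    linarith
  · obtain ⟨x, w⟩ := u
    have hgen : saddleForm H D ε (x, w) (saddleGen A K D Dt (x, w)) =
        -⟪K x, x⟫_ℝ + ε * (⟪H x, D (Dt x)⟫_ℝ - ⟪K x, D w⟫_ℝ - ‖D w‖ ^ 2) := by
      have e1 : saddleGen A K D Dt (x, w) = (-(A (K x + D w)), Dt x) := rfl
      rw [saddleForm_apply, e1]
      simp only [map_neg, hHA, inner_neg_right, hH x]
      rw [real_inner_comm (Dt x), hD, inner_add_right, inner_add_right, real_inner_comm (K x) x,
        real_inner_comm (K x) (D w), real_inner_self_eq_norm_sq]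
      ring
    rw [hgen]
    have h1 := norm_sq_prod_le (x, w)
    have h2 := hKκ x
    have h3 := hB₁ x
    have h4 := hB₂ x w
    have h5 : b₂ * ‖x‖ * ‖D w‖ ≤ b₂ ^ 2 / 2 * ‖x‖ ^ 2 + ‖D w‖ ^ 2 / 2 := by
      nlinarith [sq_nonneg (b₂ * ‖x‖ - ‖D w‖)]
    have h6 : ε * (⟪H x, D (Dt x)⟫_ℝ - ⟪K x, D w⟫_ℝ - ‖D w‖ ^ 2) ≤
        ε * ((b₁ + b₂ ^ 2 / 2) * ‖x‖ ^ 2 - ‖D w‖ ^ 2 / 2) :=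
      mul_le_mul_of_nonneg_left (by linarith) hε.le
    have h7 : ε * (b₁ + b₂ ^ 2 / 2) * ‖x‖ ^ 2 ≤ κ / 2 * ‖x‖ ^ 2 :=
      mul_le_mul_of_nonneg_right hε₁ (sq_nonneg _)
    have h8 : ε / 2 * (σ * ‖w‖ ^ 2) ≤ ε / 2 * ‖D w‖ ^ 2 :=
      mul_le_mul_of_nonneg_left (hDσ w) (by positivity)
    have h9 : min (κ / 2) (ε * σ / 2) * ‖(x, w)‖ ^ 2 ≤
        min (κ / 2) (ε * σ / 2) * (‖x‖ ^ 2 + ‖w‖ ^ 2) :=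
      mul_le_mul_of_nonneg_left h1 (by positivity)
    have h10 : min (κ / 2) (ε * σ / 2) * ‖x‖ ^ 2 ≤ κ / 2 * ‖x‖ ^ 2 :=
      mul_le_mul_of_nonneg_right (min_le_left _ _) (sq_nonneg _)
    have h11 : min (κ / 2) (ε * σ / 2) * ‖w‖ ^ 2 ≤ ε * σ / 2 * ‖w‖ ^ 2 :=
      mul_le_mul_of_nonneg_right (min_le_right _ _) (sq_nonneg _)
    linarith

/-- The map `(z, w) ↦ (A z, w)` intertwines the two generators, and `z = H (A z)` bounds it from
below. -/
theorem HasLyapunovForm.dualSaddleGen {H A K : U →L[ℝ] U} {D : W →L[ℝ] U} {Dt : U →L[ℝ] W}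
    (hHA : ∀ x, H (A x) = x) (h : HasLyapunovForm (saddleGen A K D Dt)) :
    HasLyapunovForm (dualSaddleGen A K D Dt) := by
  refine h.of_semiconj ((A ∘L ContinuousLinearMap.fst ℝ U W).prod (ContinuousLinearMap.snd ℝ U W))
    (b := (‖H‖ + 1)⁻¹) (fun u => ?_) (by positivity) fun u => ?_
  · simp [DMD.dualSaddleGen, saddleGen]
  · rw [inv_mul_le_iff₀ (by positivity)]
    have h1 : ‖u.1‖ ≤ ‖H‖ * ‖A u.1‖ := by simpa [hHA] using H.le_opNorm (A u.1)
    have h2 : ‖A u.1‖ ≤ ‖(A u.1, u.2)‖ := norm_fst_le (A u.1, u.2)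
    have h3 : ‖u.2‖ ≤ ‖(A u.1, u.2)‖ := norm_snd_le (A u.1, u.2)
    have h4 : 0 ≤ ‖H‖ := norm_nonneg _
    change ‖u‖ ≤ (‖H‖ + 1) * ‖(A u.1, u.2)‖
    rw [Prod.norm_def u]
    refine max_le (h1.trans ?_) (h3.trans ?_) <;> nlinarith [norm_nonneg (A u.1, u.2)]

end Saddle

/-! ### Convexity in terms of gradients and their derivatives -/

section Convex

variable {V : Type*} [NormedAddCommGroup V] [InnerProductSpace ℝ V]

theorem tendsto_slope_along {F : Type*} [NormedAddCommGroup F] [NormedSpace ℝ F] {f : V → F}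
    {f' : V →L[ℝ] F} {x : V} (h : HasFDerivAt f f' x) (v : V) :
    Filter.Tendsto (fun t : ℝ => t⁻¹ • (f (x + t • v) - f x)) (𝓝[>] 0) (𝓝 (f' v)) :=
  (h.hasLineDerivAt v).tendsto_slope_zero_right

theorem add_fderiv_le_of_convexOn {s : Set V} {f : V → ℝ} (hf : ConvexOn ℝ s f) {x y : V}
    (hx : x ∈ s) (hy : y ∈ s) {f' : V →L[ℝ] ℝ} (h : HasFDerivAt f f' x) :
    f x + f' (y - x) ≤ f y := by
  have hlim := tendsto_slope_along h (y - x)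
  have hle : f' (y - x) ≤ f y - f x := by
    refine le_of_tendsto hlim ?_
    filter_upwards [Ioo_mem_nhdsGT (zero_lt_one (α := ℝ))] with t ht
    have h1 := hf.2 hx hy (sub_nonneg.2 ht.2.le) ht.1.le (sub_add_cancel 1 t)
    have h2 : (1 - t) • x + t • y = x + t • (y - x) := by module
    rw [h2] at h1
    simp only [smul_eq_mul] at h1 ⊢
    rw [inv_mul_le_iff₀ ht.1]
    linarith
  linarith

/-- Monotonicity between `x₀` and `x₀ + t • v`, divided by `t²`, passes to the limit `t → 0`. -/
theorem le_inner_of_monotone_near {G : V → V} {B : V →L[ℝ] V} {x₀ : V} {m : ℝ}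
    (hG : HasFDerivAt G B x₀)
    (hm : ∀ᶠ x in 𝓝 x₀, m * ‖x - x₀‖ ^ 2 ≤ ⟪G x - G x₀, x - x₀⟫_ℝ) (v : V) :
    m * ‖v‖ ^ 2 ≤ ⟪B v, v⟫_ℝ := by
  have hlim : Filter.Tendsto (fun t : ℝ => ⟪t⁻¹ • (G (x₀ + t • v) - G x₀), v⟫_ℝ) (𝓝[>] 0)
      (𝓝 ⟪B v, v⟫_ℝ) := (tendsto_slope_along hG v).inner tendsto_const_nhds
  refine ge_of_tendsto hlim ?_
  have hcont : Filter.Tendsto (fun t : ℝ => x₀ + t • v) (𝓝[>] 0) (𝓝 x₀) := by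
    have h : Continuous fun t : ℝ => x₀ + t • v := by fun_prop
    simpa using (h.tendsto 0).mono_left nhdsWithin_le_nhds
  filter_upwards [hcont.eventually hm, self_mem_nhdsWithin] with t ht ht0
  have ht0 : 0 < t := ht0
  rw [add_sub_cancel_left, norm_smul, inner_smul_right, Real.norm_of_nonneg ht0.le] at ht
  rw [real_inner_smul_left, le_inv_mul_iff₀ ht0]
  refine le_of_mul_le_mul_left ?_ ht0
  nlinarith

theorem exists_inverse_of_coercive [FiniteDimensional ℝ V] {H : V →L[ℝ] V} {m : ℝ} (hm : 0 < m)
    (hH : ∀ v, m * ‖v‖ ^ 2 ≤ ⟪H v, v⟫_ℝ) : ∃ e : V ≃L[ℝ] V, (e : V →L[ℝ] V) = H := by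
  have hinj : Function.Injective (H : V →ₗ[ℝ] V) := by
    refine (injective_iff_map_eq_zero _).2 fun v hv => ?_
    have h := hH v
    rw [show H v = 0 from hv, inner_zero_left] at h
    have h2 : ‖v‖ ^ 2 ≤ 0 := nonpos_of_mul_nonpos_right h hm
    simpa using h2
  exact ⟨(LinearEquiv.ofInjectiveEndo (H : V →ₗ[ℝ] V) hinj).toContinuousLinearEquiv, by ext; rfl⟩

variable [CompleteSpace V]

/-- Subtracting `m / 2 * ‖x‖ ^ 2` leaves a convex function; its first-order inequalities at `x` and
at `y` are added. -/
theorem StrongConvexOn.gradient_monotone {s : Set V} {f : V → ℝ} {m : ℝ}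
    (hf : StrongConvexOn s m f) {x y gx gy : V} (hx : x ∈ s) (hy : y ∈ s)
    (hgx : HasGradientAt f gx x) (hgy : HasGradientAt f gy y) :
    m * ‖x - y‖ ^ 2 ≤ ⟪gx - gy, x - y⟫_ℝ := by
  have hconv := strongConvexOn_iff_convex.1 hf
  have hder : ∀ {u gu : V}, HasGradientAt f gu u →
      HasFDerivAt (fun x => f x - m / 2 * ‖x‖ ^ 2)
        (InnerProductSpace.toDual ℝ V gu - (m / 2) • (2 • innerSL ℝ u)) u := fun {u gu} h =>
    h.hasFDerivAt.sub ((hasStrictFDerivAt_norm_sq u).hasFDerivAt.const_mul (m / 2))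
  have h1 := add_fderiv_le_of_convexOn hconv hx hy (hder hgx)
  have h2 := add_fderiv_le_of_convexOn hconv hy hx (hder hgy)
  simp only [sub_apply, InnerProductSpace.toDual_apply_apply,
    smul_apply, innerSL_apply_apply, smul_eq_mul, nsmul_eq_mul] at h1 h2
  rw [← real_inner_self_eq_norm_sq]
  simp only [inner_sub_left, inner_sub_right, real_inner_comm x y] at h1 h2 ⊢
  push_cast at h1 h2
  linarith

theorem StrongConvexOn.le_inner_deriv_gradient {s : Set V} {f : V → ℝ} {m : ℝ}
    (hf : StrongConvexOn s m f) {G : V → V} {B : V →L[ℝ] V} {x₀ : V} (hs : s ∈ 𝓝 x₀)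
    (hG : ∀ᶠ x in 𝓝 x₀, HasGradientAt f (G x) x) (hB : HasFDerivAt G B x₀) (v : V) :
    m * ‖v‖ ^ 2 ≤ ⟪B v, v⟫_ℝ := by
  refine le_inner_of_monotone_near hB ?_ v
  filter_upwards [hs, hG] with x hx hgx
  exact StrongConvexOn.gradient_monotone hf hx (mem_of_mem_nhds hs) hgx hG.self_of_nhds

/-- This is the symmetry of second derivatives, read through the Riesz identification. -/
theorem inner_deriv_gradient_comm {f : V → ℝ} {G : V → V} {B : V →L[ℝ] V} {x₀ : V}
    (hG : ∀ᶠ x in 𝓝 x₀, HasGradientAt f (G x) x) (hB : HasFDerivAt G B x₀) (v w : V) :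
    ⟪B v, w⟫_ℝ = ⟪v, B w⟫_ℝ := by
  have hdual : HasFDerivAt (fun x => (innerSL ℝ (G x) : V →L[ℝ] ℝ))
      ((innerSL ℝ : V →L[ℝ] V →L[ℝ] ℝ) ∘L B) x₀ :=
    (innerSL ℝ : V →L[ℝ] V →L[ℝ] ℝ).hasFDerivAt.comp x₀ hB
  have h := second_derivative_symmetric_of_eventually (hG.mono fun x hx => hx.hasFDerivAt) hdual v w
  rw [real_inner_comm (B w) v]
  exact h

end Convex

/-! ### The gradient of the convex conjugate as a local inverse -/

section Conjugate

variable {d : ℕ} {𝒳 : Set (Vec d)} {φ : Vec d → ℝ}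

/-- By the first-order inequality the supremum is attained where the gradient equals `z`, so the
real-valued supremum takes no default value there. -/
theorem conjugate_isGreatest (hφ : ConvexOn ℝ 𝒳 φ) {x z : Vec d} (hx : x ∈ 𝒳)
    (hg : HasGradientAt φ z x) :
    IsGreatest (Set.range fun y : 𝒳 => ⟪(y : Vec d), z⟫_ℝ - φ y) (⟪x, z⟫_ℝ - φ x) := by
  refine ⟨⟨⟨x, hx⟩, rfl⟩, ?_⟩
  rintro _ ⟨⟨y, hy⟩, rfl⟩
  have h := add_fderiv_le_of_convexOn hφ hx hy hg.hasFDerivAt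
  rw [InnerProductSpace.toDual_apply_apply, inner_sub_right, real_inner_comm y z,
    real_inner_comm x z] at h
  simp only
  linarith

theorem conjugate_eq (hφ : ConvexOn ℝ 𝒳 φ) {x z : Vec d} (hx : x ∈ 𝒳)
    (hg : HasGradientAt φ z x) : conjugate 𝒳 φ z = ⟪x, z⟫_ℝ - φ x :=
  (conjugate_isGreatest hφ hx hg).csSup_eq

theorem le_conjugate (hφ : ConvexOn ℝ 𝒳 φ) {x y z : Vec d} (hx : x ∈ 𝒳) (hy : y ∈ 𝒳)
    (hg : HasGradientAt φ z x) : ⟪y, z⟫_ℝ - φ y ≤ conjugate 𝒳 φ z := by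
  rw [conjugate_eq hφ hx hg]
  exact (conjugate_isGreatest hφ hx hg).2 ⟨⟨y, hy⟩, rfl⟩

/-- The gradient of the convex conjugate inverts the gradient, along a continuous local inverse. -/
theorem hasGradientAt_conjugate (hφ : ConvexOn ℝ 𝒳 φ) {X : Vec d → Vec d} {z : Vec d}
    (hX : ∀ᶠ z' in 𝓝 z, X z' ∈ 𝒳 ∧ HasGradientAt φ z' (X z')) (hcont : ContinuousAt X z) :
    HasGradientAt (conjugate 𝒳 φ) (X z) z := by
  rw [hasGradientAt_iff_isLittleO]
  -- The Fenchel inequality, used at `z` and at `z'`, places the remainder between `0` and `⟨X z' -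
  -- X z, z' - z⟩`.
  have h1 : (fun z' => conjugate 𝒳 φ z' - conjugate 𝒳 φ z - ⟪X z, z' - z⟫_ℝ) =O[𝓝 z]
      fun z' => ‖X z' - X z‖ * ‖z' - z‖ := by
    refine Asymptotics.IsBigO.of_bound 1 ?_
    filter_upwards [hX] with z' hz'
    have hz := hX.self_of_nhds
    have e1 := conjugate_eq hφ hz.1 hz.2
    have e2 := conjugate_eq hφ hz'.1 hz'.2
    have i1 := le_conjugate hφ hz'.1 hz.1 hz'.2
    have i2 := le_conjugate hφ hz.1 hz'.1 hz.2
    have i3 := real_inner_le_norm (X z' - X z) (z' - z)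
    rw [Real.norm_of_nonneg, Real.norm_of_nonneg (by positivity), one_mul]
    · simp only [inner_sub_left, inner_sub_right] at i3 ⊢
      linarith
    · rw [inner_sub_right]
      linarith
  have h2 : (fun z' => ‖X z' - X z‖ * ‖z' - z‖) =o[𝓝 z] fun z' => z' - z := by
    have h3 : (fun z' => ‖X z' - X z‖) =o[𝓝 z] fun _ => (1 : ℝ) := by
      rw [Asymptotics.isLittleO_one_iff]
      have h4 : ContinuousAt (fun z' => ‖X z' - X z‖) z := (hcont.sub continuousAt_const).norm
      simpa [ContinuousAt] using h4
    have h5 := h3.mul_isBigO (Asymptotics.isBigO_refl (fun z' => ‖z' - z‖) (𝓝 z))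
    simp only [one_mul] at h5
    exact h5.trans_isBigO (Asymptotics.isBigO_refl _ _).norm_left
  exact h1.trans_isLittleO h2

/-- The inverse function theorem gives a local inverse `X` of `∇φ`. It agrees with the gradient of
the conjugate on a whole neighbourhood, so strict differentiability transfers. -/
theorem hasStrictFDerivAt_gradient_conjugate (hφ : ConvexOn ℝ 𝒳 φ) {xs : Vec d}
    (hxs : xs ∈ interior 𝒳) (hdiff : DifferentiableOn ℝ φ (interior 𝒳)) {e : Vec d ≃L[ℝ] Vec d}
    (he : HasStrictFDerivAt (gradient φ) (e : Vec d →L[ℝ] Vec d) xs) :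
    gradient (conjugate 𝒳 φ) (gradient φ xs) = xs ∧
      HasStrictFDerivAt (gradient (conjugate 𝒳 φ)) (e.symm : Vec d →L[ℝ] Vec d)
        (gradient φ xs) := by
  set X := he.localInverse (gradient φ) e xs with hXdef
  have hX : HasStrictFDerivAt X (e.symm : Vec d →L[ℝ] Vec d) (gradient φ xs) := he.to_localInverse
  have hX0 : X (gradient φ xs) = xs := he.localInverse_apply_image
  have hright : ∀ᶠ z in 𝓝 (gradient φ xs), gradient φ (X z) = z := he.eventually_right_inverse
  have hint : ∀ᶠ z in 𝓝 (gradient φ xs), X z ∈ interior 𝒳 := by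
    refine hX.hasFDerivAt.continuousAt.eventually ?_
    rw [hX0]
    exact isOpen_interior.mem_nhds hxs
  have hgood : ∀ᶠ z in 𝓝 (gradient φ xs), X z ∈ 𝒳 ∧ HasGradientAt φ z (X z) := by
    filter_upwards [hright, hint] with z hz hz'
    refine ⟨interior_subset hz', ?_⟩
    have h := (hdiff.differentiableAt (isOpen_interior.mem_nhds hz')).hasGradientAt
    rwa [hz] at h
  have hcont : ∀ᶠ z in 𝓝 (gradient φ xs), ContinuousAt X z := by
    obtain ⟨K, s, hs, hK⟩ := hX.exists_lipschitzOnWith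
    filter_upwards [eventually_mem_nhds_iff.2 hs] with z hz
    exact hK.continuousOn.continuousAt hz
  have heq : X =ᶠ[𝓝 (gradient φ xs)] gradient (conjugate 𝒳 φ) := by
    filter_upwards [eventually_eventually_nhds.2 hgood, hcont] with z hz hz'
    exact (hasGradientAt_conjugate hφ hz hz').gradient.symm
  exact ⟨heq.self_of_nhds ▸ hX0, hX.congr_of_eventuallyEq heq⟩

end Conjugate

/-! ### Blockwise calculus on stacked vectors -/

section Stacks

variable {m n k d : ℕ}

theorem inner_stack (x y : Stack n d) : ⟪x, y⟫_ℝ = ∑ i, ⟪block x i, block y i⟫_ℝ := by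
  simp only [PiLp.inner_apply, Fintype.sum_prod_type, block]

@[simp] theorem block_col (v : Fin n → Vec d) (i : Fin n) : block (col v) i = v i := rfl

@[simp] theorem col_block (x : Stack n d) : col (block x) = x := rfl

theorem stack_ext {x y : Stack n d} (h : ∀ i, block x i = block y i) : x = y := by
  rw [← col_block x, ← col_block y, funext h]

@[simp] theorem block_add (x y : Stack n d) (i : Fin n) :
    block (x + y) i = block x i + block y i := rfl

@[simp] theorem block_neg (x : Stack n d) (i : Fin n) : block (-x) i = -block x i := rfl

@[simp] theorem block_zero (i : Fin n) : block (0 : Stack n d) i = 0 := rfl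

/-- The `i`-th block as a continuous linear map. -/
noncomputable def blockL (i : Fin n) : Stack n d →L[ℝ] Vec d :=
  LinearMap.toContinuousLinearMap
    { toFun := fun x => block x i, map_add' := fun _ _ => rfl, map_smul' := fun _ _ => rfl }

@[simp] theorem blockL_apply (i : Fin n) (x : Stack n d) : blockL i x = block x i := rfl

/-- Stacking as a continuous linear map. -/
noncomputable def colL : (Fin n → Vec d) →L[ℝ] Stack n d :=
  LinearMap.toContinuousLinearMap
    { toFun := col, map_add' := fun _ _ => rfl, map_smul' := fun _ _ => rfl }

@[simp] theorem colL_apply (v : Fin n → Vec d) : colL v = col v := rfl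

/-- The block diagonal operator with blocks `B i`. -/
noncomputable def blockDiag (B : Fin n → Vec d →L[ℝ] Vec d) : Stack n d →L[ℝ] Stack n d :=
  colL ∘L ContinuousLinearMap.pi fun i => B i ∘L blockL i

@[simp] theorem block_blockDiag (B : Fin n → Vec d →L[ℝ] Vec d) (x : Stack n d) (i : Fin n) :
    block (blockDiag B x) i = B i (block x i) := rfl

/-- Strict differentiability of a stacked map, blockwise. -/
theorem hasStrictFDerivAt_col {E : Type*} [NormedAddCommGroup E] [NormedSpace ℝ E]
    {g : Fin n → E → Vec d} {g' : Fin n → E →L[ℝ] Vec d} {u : E}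
    (h : ∀ i, HasStrictFDerivAt (g i) (g' i) u) :
    HasStrictFDerivAt (fun u => col fun i => g i u) (colL ∘L ContinuousLinearMap.pi g') u :=
  colL.hasStrictFDerivAt.comp u (hasStrictFDerivAt_pi.2 h)

theorem hasStrictFDerivAt_col_block {g : Fin n → Vec d → Vec d} {B : Fin n → Vec d →L[ℝ] Vec d}
    {x : Stack n d} (h : ∀ i, HasStrictFDerivAt (g i) (B i) (block x i)) :
    HasStrictFDerivAt (fun x => col fun i => g i (block x i)) (blockDiag B) x :=
  hasStrictFDerivAt_col fun i => (h i).comp x (blockL i).hasStrictFDerivAt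

/-- The action of a matrix on stacked vectors as a continuous linear map. -/
noncomputable def actL (A : Matrix (Fin m × Fin d) (Fin n × Fin d) ℝ) :
    Stack n d →L[ℝ] Stack m d :=
  LinearMap.toContinuousLinearMap (Matrix.toEuclideanLin A)

@[simp] theorem actL_apply (A : Matrix (Fin m × Fin d) (Fin n × Fin d) ℝ) (x : Stack n d) :
    actL A x = act A x := rfl

theorem act_mul (A : Matrix (Fin m × Fin d) (Fin k × Fin d) ℝ)
    (B : Matrix (Fin k × Fin d) (Fin n × Fin d) ℝ) (x : Stack n d) :
    act (A * B) x = act A (act B x) := by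
  simp [act, Matrix.toLpLin_apply, Matrix.mulVec_mulVec]

theorem act_one (x : Stack n d) : act 1 x = x := by
  simp [act]

theorem inner_act (A : Matrix (Fin m × Fin d) (Fin n × Fin d) ℝ) (x : Stack n d) (y : Stack m d) :
    ⟪act A x, y⟫_ℝ = ⟪x, act A.transpose y⟫_ℝ := by
  simp only [EuclideanSpace.inner_eq_star_dotProduct, act, Matrix.toLpLin_apply,
    star_trivial]
  rw [Matrix.mulVec_transpose, Matrix.dotProduct_mulVec]

theorem act_kronId_apply (A : Matrix (Fin m) (Fin n) ℝ) (x : Stack n d) (i : Fin m) (l : Fin d) :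
    act (kronId d A) x (i, l) = A.mulVec (fun j => x (j, l)) i := by
  simp [act, kronId, Matrix.toLpLin_apply, Matrix.mulVec, dotProduct, Fintype.sum_prod_type,
    Matrix.kroneckerMap_apply, Matrix.one_apply]

end Stacks

/-! ### The Laplacian, its square root and the balanced vectors -/

section Network

variable {n d : ℕ} (G : SimpleGraph (Fin n)) [DecidableRel G.Adj]

theorem bigLap_posSemidef : (bigLap d G).PosSemidef :=
  (SimpleGraph.posSemidef_lapMatrix ℝ G).kronecker Matrix.PosSemidef.one

theorem sqrtLap_mul_self : sqrtLap d G * sqrtLap d G = bigLap d G :=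
  CFC.sqrt_mul_sqrt_self _ (bigLap_posSemidef G).nonneg

theorem sqrtLap_transpose : (sqrtLap d G).transpose = sqrtLap d G := by
  have h : (sqrtLap d G).PosSemidef := Matrix.nonneg_iff_posSemidef.1 (CFC.sqrt_nonneg _)
  rw [← Matrix.conjTranspose_eq_transpose_of_trivial]
  exact h.isHermitian

theorem act_bigLap (x : Stack n d) :
    act (bigLap d G) x = act (sqrtLap d G) (act (sqrtLap d G) x) := by
  rw [← act_mul, sqrtLap_mul_self]

theorem inner_act_sqrtLap (x y : Stack n d) :
    ⟪act (sqrtLap d G) x, y⟫_ℝ = ⟪x, act (sqrtLap d G) y⟫_ℝ := by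
  rw [inner_act, sqrtLap_transpose]

theorem inner_act_bigLap (x : Stack n d) :
    ⟪act (bigLap d G) x, x⟫_ℝ = ‖act (sqrtLap d G) x‖ ^ 2 := by
  rw [act_bigLap, inner_act_sqrtLap, real_inner_self_eq_norm_sq]

@[simp] theorem act_bigLap_const (v : Vec d) : act (bigLap d G) (col fun _ => v) = 0 := by
  ext ⟨i, l⟩
  rw [bigLap, act_kronId_apply]
  have h : (fun j : Fin n => (col fun _ => v : Stack n d) (j, l)) = v l • fun _ => (1 : ℝ) := by
    ext j; simp [col]
  rw [h, Matrix.mulVec_smul, SimpleGraph.lapMatrix_mulVec_const_eq_zero]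
  simp

@[simp] theorem act_sqrtLap_const (v : Vec d) : act (sqrtLap d G) (col fun _ => v) = 0 := by
  have h := inner_act_bigLap G (col fun _ => v)
  rw [act_bigLap_const, inner_zero_left] at h
  simpa using h.symm

variable {G}

/-- A vector killed by the square root is killed by the Laplacian, whose kernel, taken for each
coordinate `l`, consists of functions constant on connected components. -/
theorem block_eq_of_act_sqrtLap_eq_zero (hG : G.Connected) {x : Stack n d}
    (hx : act (sqrtLap d G) x = 0) (i j : Fin n) : block x i = block x j := by
  have hL : act (bigLap d G) x = 0 := by rw [act_bigLap, hx]; exact map_zero (actL (sqrtLap d G))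
  ext l
  have h : (G.lapMatrix ℝ).mulVec (fun j => x (j, l)) = 0 := by
    ext i
    rw [← act_kronId_apply]
    change act (bigLap d G) x (i, l) = 0
    rw [hL]; rfl
  exact G.lapMatrix_mulVec_eq_zero_iff_forall_reachable.1 h i j (hG.preconnected i j)

variable (n d) in
/-- Stacked vectors whose blocks sum to zero. -/
noncomputable def balanced : Submodule ℝ (Stack n d) :=
  (∑ i, blockL i : Stack n d →L[ℝ] Vec d).ker

theorem mem_balanced {x : Stack n d} : x ∈ balanced n d ↔ ∑ i, block x i = 0 := by
  simp [balanced]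

theorem inner_col_const (x : Stack n d) (v : Vec d) :
    ⟪x, col fun _ => v⟫_ℝ = ⟪∑ i, block x i, v⟫_ℝ := by
  simp [inner_stack, sum_inner]

variable (G) in
-- The square root is symmetric and kills constant stacks, so its range is orthogonal to them.
theorem act_sqrtLap_mem_balanced (x : Stack n d) : act (sqrtLap d G) x ∈ balanced n d := by
  rw [mem_balanced, ← inner_self_eq_zero (𝕜 := ℝ), ← inner_col_const, inner_act_sqrtLap,
    act_sqrtLap_const, inner_zero_right]

theorem eq_zero_of_consensus_of_balanced {x : Stack n d} (hc : ∀ i j, block x i = block x j)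
    (hb : x ∈ balanced n d) : x = 0 := by
  refine stack_ext fun i => ?_
  have h : x = col fun _ => block x i := stack_ext fun j => by simpa using hc j i
  have h2 := inner_col_const x (block x i)
  rw [← h, mem_balanced.1 hb, inner_zero_left, inner_self_eq_zero] at h2
  rw [h2]

variable (G) in
/-- The square root of the Laplacian, with values in the balanced vectors. -/
noncomputable def sqrtLapBalanced : Stack n d →L[ℝ] balanced n d :=
  (actL (sqrtLap d G)).codRestrict (balanced n d) (act_sqrtLap_mem_balanced G)

variable (G) in
/-- The square root of the Laplacian, restricted to the balanced vectors. -/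
noncomputable def sqrtLapRestrict : balanced n d →L[ℝ] Stack n d :=
  actL (sqrtLap d G) ∘L (balanced n d).subtypeL

/-- The square root maps balanced vectors injectively into themselves, hence bijectively in finite
dimension. `T` is the inverse preceded by a projection onto them; it recovers `w` from `y - y⋆`. -/
theorem exists_left_inverse_sqrtLap (hG : G.Connected) :
    ∃ T : Stack n d →L[ℝ] balanced n d,
      (∀ w : balanced n d, T (act (sqrtLap d G) w) = w) ∧
      ∀ y ∈ balanced n d, act (sqrtLap d G) (T y : Stack n d) = y := by
  let S₀ : balanced n d →ₗ[ℝ] balanced n d := (sqrtLapBalanced G ∘L (balanced n d).subtypeL : _)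
  have hinj : Function.Injective S₀ := by
    refine (injective_iff_map_eq_zero _).2 fun w hw => ?_
    have h : act (sqrtLap d G) (w : Stack n d) = 0 := congrArg Subtype.val hw
    exact Subtype.ext (eq_zero_of_consensus_of_balanced (block_eq_of_act_sqrtLap_eq_zero hG h) w.2)
  let e := LinearEquiv.ofInjectiveEndo S₀ hinj
  obtain ⟨P, hP⟩ := (balanced n d).subtype.exists_leftInverse_of_injective
    (Submodule.ker_subtype _)
  have hP' : ∀ y : balanced n d, P (y : Stack n d) = y := fun y => LinearMap.congr_fun hP y
  refine ⟨LinearMap.toContinuousLinearMap (e.symm.toLinearMap ∘ₗ P), fun w => ?_, fun y hy => ?_⟩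
  · change e.symm (P (S₀ w : Stack n d)) = w
    rw [hP']
    exact e.symm_apply_apply w
  · change ((S₀ (e.symm (P y)) : balanced n d) : Stack n d) = y
    rw [show P y = ⟨y, hy⟩ from hP' ⟨y, hy⟩]
    exact congrArg Subtype.val (e.apply_symm_apply ⟨y, hy⟩)

theorem kronId_mul {m n k : ℕ} (A : Matrix (Fin m) (Fin n) ℝ) (B : Matrix (Fin n) (Fin k) ℝ) :
    kronId d (A * B) = kronId d A * kronId d B := by
  simp [kronId, ← Matrix.mul_kronecker_mul]

theorem kronId_transpose {m n : ℕ} (A : Matrix (Fin m) (Fin n) ℝ) :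
    (kronId d A).transpose = kronId d A.transpose := by
  ext ⟨i, k⟩ ⟨j, l⟩
  simp [kronId, Matrix.one_apply, eq_comm]

theorem IsReduction.transpose_mul_self {R : Matrix (Fin n) (Fin (n - 1)) ℝ}
    (hR : IsReduction G R) : R.transpose * R = 1 := by
  have h := congrArg Matrix.toBlocks₂₂ hR.1
  rw [extendCols, Matrix.transpose_fromCols, Matrix.fromRows_mul_fromCols,
    Matrix.toBlocks_fromBlocks₂₂, ← Matrix.fromBlocks_one, Matrix.toBlocks_fromBlocks₂₂] at h
  exact h

/-- The off-diagonal block of `Qᵀ Q = 1` says that `r`, a nonzero multiple of the all-ones vector,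
is orthogonal to the columns of `R`. -/
theorem IsReduction.sum_col [NeZero n] {R : Matrix (Fin n) (Fin (n - 1)) ℝ}
    (hR : IsReduction G R) (j : Fin (n - 1)) : ∑ i, R i j = 0 := by
  have h := congrFun (congrFun (congrArg Matrix.toBlocks₁₂ hR.1) ()) j
  rw [extendCols, Matrix.transpose_fromCols, Matrix.fromRows_mul_fromCols,
    Matrix.toBlocks_fromBlocks₁₂, ← Matrix.fromBlocks_one, Matrix.toBlocks_fromBlocks₁₂] at h
  simp only [Matrix.mul_apply, Matrix.transpose_apply, Matrix.replicateCol_apply,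
    Matrix.zero_apply, ← Finset.mul_sum] at h
  have hn : (1 / √(n : ℝ)) ≠ 0 := by
    have : (0 : ℝ) < n := by exact_mod_cast NeZero.pos n
    positivity
  exact (mul_eq_zero.1 h).resolve_left hn

theorem IsReduction.act_mem_balanced [NeZero n] {R : Matrix (Fin n) (Fin (n - 1)) ℝ}
    (hR : IsReduction G R) (w : Stack (n - 1) d) : act (kronId d R) w ∈ balanced n d := by
  rw [mem_balanced]
  ext l
  have h : ∀ i, block (act (kronId d R) w) i l = ∑ j, R i j * w (j, l) := fun i =>
    act_kronId_apply R w i l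
  rw [WithLp.ofLp_sum, Finset.sum_apply]
  simp only [h]
  rw [Finset.sum_comm]
  simp [← Finset.sum_mul, hR.sum_col]

/-- `R` embeds into the balanced vectors, where the square root of the Laplacian is injective. -/
theorem IsReduction.act_injective [NeZero n] (hG : G.Connected)
    {R : Matrix (Fin n) (Fin (n - 1)) ℝ} (hR : IsReduction G R) {w : Stack (n - 1) d}
    (hw : act (sqrtLap d G * kronId d R) w = 0) : w = 0 := by
  rw [act_mul] at hw
  have h := eq_zero_of_consensus_of_balanced (block_eq_of_act_sqrtLap_eq_zero hG hw)
    (hR.act_mem_balanced w)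
  have h2 : act ((kronId d R).transpose * kronId d R) w = w := by
    rw [kronId_transpose, ← kronId_mul, hR.transpose_mul_self]
    simp [kronId, act_one]
  rw [← h2, act_mul, h]
  exact map_zero (actL _)

theorem inner_reduced (R : Matrix (Fin n) (Fin (n - 1)) ℝ) (x : Stack n d) (w : Stack (n - 1) d) :
    ⟪act ((kronId d R).transpose * sqrtLap d G) x, w⟫_ℝ =
      ⟪x, act (sqrtLap d G * kronId d R) w⟫_ℝ := by
  rw [inner_act, Matrix.transpose_mul, Matrix.transpose_transpose, sqrtLap_transpose]

end Network

/-! ### Coercivity by compactness of the unit sphere -/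

section Coercive

/-- A quadratic form on a finite-dimensional space that is positive off `0` is coercive. -/
theorem exists_coercive {V : Type*} [NormedAddCommGroup V] [NormedSpace ℝ V]
    [FiniteDimensional ℝ V] {q : V → ℝ} (hq : Continuous q)
    (hhom : ∀ (c : ℝ) v, q (c • v) = c ^ 2 * q v) (hpos : ∀ v, v ≠ 0 → 0 < q v) :
    ∃ m > 0, ∀ v, m * ‖v‖ ^ 2 ≤ q v := by
  have hq0 : q 0 = 0 := by simpa using hhom 0 0
  -- The zero space has an empty unit sphere and no minimizer on it.
  rcases subsingleton_or_nontrivial V with hV | hV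
  · exact ⟨1, one_pos, fun v => by rw [Subsingleton.elim v 0, hq0]; simp⟩
  · obtain ⟨u, hu, hmin⟩ := (isCompact_sphere (0 : V) 1).exists_isMinOn
      (NormedSpace.sphere_nonempty.2 zero_le_one) hq.continuousOn
    refine ⟨q u, hpos u (ne_zero_of_mem_unit_sphere ⟨u, hu⟩), fun v => ?_⟩
    rcases eq_or_ne v 0 with rfl | hv
    · simp [hq0]
    · have hv' : 0 < ‖v‖ := norm_pos_iff.2 hv
      have h1 : ‖v‖⁻¹ • v ∈ Metric.sphere (0 : V) 1 := by
        simp [norm_smul, hv'.ne']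
      have h2 : q u ≤ q (‖v‖⁻¹ • v) := hmin h1
      rw [hhom, inv_pow, le_inv_mul_iff₀ (by positivity)] at h2
      linarith

end Coercive

/-! ### Coercivity of the linearized costs -/

section Linearization

variable {n d : ℕ}

theorem inner_blockDiag (B : Fin n → Vec d →L[ℝ] Vec d) (x y : Stack n d) :
    ⟪blockDiag B x, y⟫_ℝ = ∑ i, ⟪B i (block x i), block y i⟫_ℝ := by
  simp [inner_stack]

theorem norm_sq_stack (x : Stack n d) : ‖x‖ ^ 2 = ∑ i, ‖block x i‖ ^ 2 := by
  simp only [← real_inner_self_eq_norm_sq, inner_stack]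

theorem le_inner_blockDiag {B : Fin n → Vec d →L[ℝ] Vec d} {m : ℝ}
    (hB : ∀ i v, m * ‖v‖ ^ 2 ≤ ⟪B i v, v⟫_ℝ) (x : Stack n d) :
    m * ‖x‖ ^ 2 ≤ ⟪blockDiag B x, x⟫_ℝ := by
  rw [inner_blockDiag, norm_sq_stack, Finset.mul_sum]
  exact Finset.sum_le_sum fun i _ => hB i _

theorem blockDiag_comm {B : Fin n → Vec d →L[ℝ] Vec d}
    (hB : ∀ i v w, ⟪B i v, w⟫_ℝ = ⟪v, B i w⟫_ℝ) (x y : Stack n d) :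
    ⟪blockDiag B x, y⟫_ℝ = ⟪x, blockDiag B y⟫_ℝ := by
  rw [inner_blockDiag, inner_stack]
  simp [hB]

/-- The Hessian of the costs plus the Laplacian is coercive, although the costs need only be
jointly strongly convex. -/
theorem exists_coercive_blockDiag_add_bigLap {G : SimpleGraph (Fin n)} [DecidableRel G.Adj]
    (hG : G.Connected) {B : Fin n → Vec d →L[ℝ] Vec d} (hB : ∀ i v, 0 ≤ ⟪B i v, v⟫_ℝ)
    {m : ℝ} (hm : 0 < m) (hsum : ∀ v, m * ‖v‖ ^ 2 ≤ ⟪(∑ i, B i) v, v⟫_ℝ) :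
    ∃ κ > 0, ∀ x : Stack n d, κ * ‖x‖ ^ 2 ≤ ⟪(blockDiag B + actL (bigLap d G)) x, x⟫_ℝ := by
  refine exists_coercive (by fun_prop) (fun c x => ?_) fun x hx => ?_
  · rw [map_smul, real_inner_smul_left, real_inner_smul_right]; ring
  · have h1 : 0 ≤ ⟪blockDiag B x, x⟫_ℝ := by
      rw [inner_blockDiag]; exact Finset.sum_nonneg fun i _ => hB i _
    have h2 := inner_act_bigLap G x
    rw [add_apply, inner_add_left, actL_apply, h2]
    -- If the form is not positive, both nonnegative terms vanish: the Laplacian term forces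
    -- consensus, and the sum of the `B i` then forces the common block to be zero.
    by_contra! hle
    have h3 : act (sqrtLap d G) x = 0 := by
      have : ‖act (sqrtLap d G) x‖ ^ 2 ≤ 0 := by linarith
      simpa using this
    have h4 : ⟪blockDiag B x, x⟫_ℝ ≤ 0 := by linarith [sq_nonneg ‖act (sqrtLap d G) x‖]
    obtain ⟨i₀⟩ := hG.nonempty
    have hcons : ∀ i, block x i = block x i₀ := fun i =>
      block_eq_of_act_sqrtLap_eq_zero hG h3 i i₀
    rw [inner_blockDiag] at h4
    simp only [hcons] at h4
    have h5 := hsum (block x i₀)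
    rw [sum_apply, sum_inner] at h5
    have h6 : ‖block x i₀‖ ^ 2 ≤ 0 := nonpos_of_mul_nonpos_right (h5.trans h4) hm
    have h7 : block x i₀ = 0 := by simpa using h6
    exact hx (stack_ext fun i => by rw [hcons, h7, block_zero])

theorem gradient_eq_zero_of_isMinOn {s : Set (Vec d)} {F : Vec d → ℝ} {x g : Vec d}
    (hs : s ∈ 𝓝 x) (hmin : IsMinOn F s x) (hg : HasGradientAt F g x) : g = 0 := by
  simpa using (hmin.isLocalMin hs).hasFDerivAt_eq_zero hg.hasFDerivAt

end Linearization

/-! ### The two vector fields and their linearizations -/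

section Fields

variable {n d : ℕ} (𝒳 : Set (Vec d)) (f : Fin n → Vec d → ℝ) (φ : Vec d → ℝ)
  (G : SimpleGraph (Fin n)) [DecidableRel G.Adj] (xs : Vec d)

/-- The vector field of the reduced system. -/
noncomputable def reducedField (R : Matrix (Fin n) (Fin (n - 1)) ℝ)
    (p : Stack n d × Stack (n - 1) d) : Stack n d × Stack (n - 1) d :=
  (-(invHessianStack φ (p.1 + col fun _ => xs)
      (gradStack 𝒳 f (p.1 + col fun _ => xs) - gradStack 𝒳 f (col fun _ => xs)
        + act (bigLap d G) p.1 + act (sqrtLap d G * kronId d R) p.2)),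
    act ((kronId d R).transpose * sqrtLap d G) p.1)

theorem isReducedSolution_iff (R : Matrix (Fin n) (Fin (n - 1)) ℝ) :
    IsReducedSolution 𝒳 f φ G R xs = IsODESol (reducedField 𝒳 f φ G xs R) := by
  funext J p
  refine propext (forall₂_congr fun t _ => ⟨fun h => h.1.prodMk h.2, fun h => ⟨h.fst, h.snd⟩⟩)

/-- The vector field of the original system in the states `(𝐳 - 𝐳⋆, w)`, where `𝐲 = 𝐲⋆ + 𝐒 w`. -/
noncomputable def dualField (p : Stack n d × balanced n d) : Stack n d × balanced n d :=
  (-(gradStack 𝒳 f (mirror 𝒳 φ (p.1 + col fun _ => gradient φ xs))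
      + act (bigLap d G) (mirror 𝒳 φ (p.1 + col fun _ => gradient φ xs))
      + (-gradStack 𝒳 f (col fun _ => xs) + act (sqrtLap d G) (p.2 : Stack n d))),
    sqrtLapBalanced G (mirror 𝒳 φ (p.1 + col fun _ => gradient φ xs)))

variable {𝒳 f φ xs}

theorem hasStrictFDerivAt_mirror {e : Vec d ≃L[ℝ] Vec d}
    (he : HasStrictFDerivAt (gradient (conjugate 𝒳 φ)) (e.symm : Vec d →L[ℝ] Vec d)
      (gradient φ xs)) :
    HasStrictFDerivAt (mirror 𝒳 φ : Stack n d → Stack n d)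
      (blockDiag fun _ => (e.symm : Vec d →L[ℝ] Vec d)) (col fun _ => gradient φ xs) :=
  hasStrictFDerivAt_col_block fun _ => he

theorem mirror_dual (he : gradient (conjugate 𝒳 φ) (gradient φ xs) = xs) :
    mirror 𝒳 φ (col fun _ => gradient φ xs : Stack n d) = col fun _ => xs := by
  simp [mirror, he]

theorem hasStrictFDerivAt_gradStack {B : Fin n → Vec d →L[ℝ] Vec d}
    (hB : ∀ i, HasStrictFDerivAt (gradientWithin (f i) 𝒳) (B i) xs) :
    HasStrictFDerivAt (gradStack 𝒳 f) (blockDiag B) (col fun _ => xs) :=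
  hasStrictFDerivAt_col_block hB

theorem hasStrictFDerivAt_dualField {e : Vec d ≃L[ℝ] Vec d}
    (he₀ : gradient (conjugate 𝒳 φ) (gradient φ xs) = xs)
    (he : HasStrictFDerivAt (gradient (conjugate 𝒳 φ)) (e.symm : Vec d →L[ℝ] Vec d)
      (gradient φ xs)) {B : Fin n → Vec d →L[ℝ] Vec d}
    (hB : ∀ i, HasStrictFDerivAt (gradientWithin (f i) 𝒳) (B i) xs) :
    HasStrictFDerivAt (dualField 𝒳 f φ G xs)
      (dualSaddleGen (blockDiag fun _ => (e.symm : Vec d →L[ℝ] Vec d))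
        (blockDiag B + actL (bigLap d G)) (sqrtLapRestrict G) (sqrtLapBalanced G)) 0 := by
  have hm : HasStrictFDerivAt
      (fun p : Stack n d × balanced n d => mirror 𝒳 φ (p.1 + col fun _ => gradient φ xs))
      ((blockDiag fun _ => (e.symm : Vec d →L[ℝ] Vec d)) ∘L ContinuousLinearMap.fst ℝ _ _) 0 := by
    refine HasStrictFDerivAt.comp (g := mirror 𝒳 φ) 0 ?_
      ((ContinuousLinearMap.fst ℝ (Stack n d) (balanced n d)).hasStrictFDerivAt.add_const _)
    simpa using hasStrictFDerivAt_mirror he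
  have hg := HasStrictFDerivAt.comp (g := gradStack 𝒳 f) (0 : Stack n d × balanced n d)
    (by simpa [mirror_dual he₀] using hasStrictFDerivAt_gradStack hB) hm
  have hL := HasStrictFDerivAt.comp (g := actL (bigLap d G)) (0 : Stack n d × balanced n d)
    (actL (bigLap d G)).hasStrictFDerivAt hm
  have hw := (sqrtLapRestrict G ∘L ContinuousLinearMap.snd ℝ (Stack n d)
    (balanced n d)).hasStrictFDerivAt (x := 0)
  have hS := HasStrictFDerivAt.comp (g := sqrtLapBalanced G) (0 : Stack n d × balanced n d)
    (sqrtLapBalanced G).hasStrictFDerivAt hm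
  exact ((hg.add hL).add (hw.const_add (-gradStack 𝒳 f (col fun _ => xs)))).neg.prodMk hS

/-- The bracket vanishes at the origin, so the derivative of the inverse Hessian is multiplied by
zero and drops out of the product rule. That inverse must still be strictly differentiable, which is
where a continuously differentiable Hessian enters. -/
theorem hasStrictFDerivAt_reducedField (R : Matrix (Fin n) (Fin (n - 1)) ℝ)
    {e : Vec d ≃L[ℝ] Vec d} (he : hessian φ xs = e) (hφ : ContDiffAt ℝ 1 (hessian φ) xs)
    {B : Fin n → Vec d →L[ℝ] Vec d}
    (hB : ∀ i, HasStrictFDerivAt (gradientWithin (f i) 𝒳) (B i) xs) :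
    HasStrictFDerivAt (reducedField 𝒳 f φ G xs R)
      (saddleGen (blockDiag fun _ => (e.symm : Vec d →L[ℝ] Vec d))
        (blockDiag B + actL (bigLap d G)) (actL (sqrtLap d G * kronId d R))
        (actL ((kronId d R).transpose * sqrtLap d G))) 0 := by
  set fstL := ContinuousLinearMap.fst ℝ (Stack n d) (Stack (n - 1) d)
  set sndL := ContinuousLinearMap.snd ℝ (Stack n d) (Stack (n - 1) d)
  have hx : HasStrictFDerivAt
      (fun p : Stack n d × Stack (n - 1) d => p.1 + col fun _ => xs) fstL 0 :=
    fstL.hasStrictFDerivAt.add_const _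
  have hg := HasStrictFDerivAt.comp (g := gradStack 𝒳 f) (0 : Stack n d × Stack (n - 1) d)
    (by simpa using hasStrictFDerivAt_gradStack hB) hx
  have hL := (actL (bigLap d G) ∘L fstL).hasStrictFDerivAt (x := 0)
  have hw := (actL (sqrtLap d G * kronId d R) ∘L sndL).hasStrictFDerivAt (x := 0)
  have hv := ((hg.sub_const (gradStack 𝒳 f (col fun _ => xs))).add hL).add hw
  have hinv : HasStrictFDerivAt (fun x => (hessian φ x).inverse)
      (fderiv ℝ (fun x => (hessian φ x).inverse) xs) xs := by
    refine ContDiffAt.hasStrictFDerivAt (n := 1) ?_ one_ne_zero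
    refine ContDiffAt.comp (g := ContinuousLinearMap.inverse) xs ?_ hφ
    rw [he]
    exact contDiffAt_map_inverse e
  have hcol := hasStrictFDerivAt_col fun i =>
    (HasStrictFDerivAt.comp (g := fun x => (hessian φ x).inverse)
      (f := fun p : Stack n d × Stack (n - 1) d => block (p.1 + col fun _ => xs) i) 0
      (by simpa using hinv) ((blockL i).hasStrictFDerivAt.comp 0 hx)).clm_apply
    ((blockL i).hasStrictFDerivAt.comp 0 hv)
  have hS := (actL ((kronId d R).transpose * sqrtLap d G) ∘L fstL).hasStrictFDerivAt (x := 0)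
  refine (hcol.neg.prodMk hS).congr_fderiv ?_
  refine ContinuousLinearMap.ext fun p => Prod.ext (congrArg Neg.neg (stack_ext fun i => ?_)) rfl
  have h0 : act (bigLap d G) (0 : Stack n d) = 0 := map_zero (actL _)
  have h0' : act (sqrtLap d G * kronId d R) (0 : Stack (n - 1) d) = 0 := map_zero (actL _)
  simp [he, h0, h0', fstL, sndL]

end Fields

/-! ### Return from the reduced states to the original system -/

section Original

variable {n d : ℕ} {𝒳 : Set (Vec d)} {f : Fin n → Vec d → ℝ} {φ : Vec d → ℝ}
  {G : SimpleGraph (Fin n)} [DecidableRel G.Adj] {xs : Vec d}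

theorem act_bigLap_mem_balanced (x : Stack n d) : act (bigLap d G) x ∈ balanced n d := by
  rw [act_bigLap]; exact act_sqrtLap_mem_balanced G _

/-- Along solutions of the original system the sum of the `yᵢ` is conserved. -/
theorem IsSolution.sub_mem_balanced {T : ℝ} {q : ℝ → Stack n d × Stack n d × Stack n d}
    (hq : IsSolution 𝒳 f φ G (Set.Icc 0 T) q) {t : ℝ} (ht : t ∈ Set.Icc 0 T) :
    (q t).2.1 - (q 0).2.1 ∈ balanced n d := by
  set σ : Stack n d →L[ℝ] Vec d := ∑ i, blockL i
  have hσ : ∀ s ∈ Set.Icc 0 T, HasDerivWithinAt (fun s => σ (q s).2.1) 0 (Set.Icc 0 T) s := by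
    intro s hs
    have h := σ.hasFDerivAt.comp_hasDerivWithinAt s (hq s hs).2.1
    have h0 : σ (act (bigLap d G) (q s).2.2) = 0 := act_bigLap_mem_balanced _
    rw [h0] at h
    exact h
  have h := constant_of_has_deriv_right_zero (fun s hs => (hσ s hs).continuousWithinAt)
    (fun s hs => hasDerivWithinAt_Ici_of_Icc hs (hσ s (Set.Ico_subset_Icc_self hs))) t ht
  change σ _ = 0
  rw [map_sub, h, sub_self]

/-- Exponential stability transfers from the states `(𝐳 - 𝐳⋆, w)` to the states `(𝐳, 𝐲, 𝐱)`. -/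
theorem isLocallyExpStable_of_dualField (hG : G.Connected)
    (h : IsLocallyExpStable (IsODESol (dualField 𝒳 f φ G xs)) Set.univ 0)
    (hsum : ∑ i, gradientWithin (f i) 𝒳 xs = 0) {A : Stack n d →L[ℝ] Stack n d}
    (hm₀ : mirror 𝒳 φ (col fun _ => gradient φ xs : Stack n d) = col fun _ => xs)
    (hm : HasStrictFDerivAt (mirror 𝒳 φ : Stack n d → Stack n d) A (col fun _ => gradient φ xs)) :
    IsLocallyExpStable (IsSolution 𝒳 f φ G) (admissible n 𝒳 φ) (equilibrium 𝒳 f φ xs) := by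
  obtain ⟨T, hTS, hST⟩ := exists_left_inverse_sqrtLap (d := d) hG
  obtain ⟨-, -, δ, hδ, C, hC, ρ, hρ, hsol⟩ := h
  set zs : Stack n d := col fun _ => gradient φ xs with hzs
  set ys : Stack n d := -gradStack 𝒳 f (col fun _ => xs) with hys
  have hys_bal : ys ∈ balanced n d := by
    rw [mem_balanced]
    simp [hys, gradStack, hsum]
  obtain ⟨Km, s, hs, hKm⟩ := hm.exists_lipschitzOnWith
  obtain ⟨r, hr, hrs⟩ := Metric.nhds_basis_closedBall.mem_iff.1 hs
  have hmir : ∀ u : Stack n d, ‖u‖ ≤ r → ‖mirror 𝒳 φ (u + zs) - col fun _ => xs‖ ≤ Km * ‖u‖ := by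
    intro u hu
    have h := hKm.dist_le_mul (u + zs) (hrs (by simpa [dist_eq_norm] using hu)) zs
      (mem_of_mem_nhds hs)
    rwa [hm₀, dist_eq_norm, dist_eq_norm, add_sub_cancel_right] at h
  set S : Stack n d →L[ℝ] Stack n d := actL (sqrtLap d G)
  set N : ℝ := ‖T‖ + 1 with hN
  have hN0 : 0 < N := by positivity
  -- `δ / N` puts the transformed initial state within `δ`; `r / (C * N)` keeps `z` where the mirror
  -- map is Lipschitz. The summands `1`, `‖S‖`, `Km` bound the errors in `z`, `y`, `x` respectively.
  refine ⟨⟨mem_balanced.1 hys_bal, hm₀.symm⟩, fun t _ => ⟨?_, ?_, hm₀.symm⟩,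
    min (δ / N) (r / (C * N)), by positivity, (1 + ‖S‖ + Km) * (C * N), by positivity, ρ, hρ,
    fun p₀ hp₀ hp₀δ => ?_⟩
  · simpa [equilibrium] using hasDerivWithinAt_const t (Set.Ici 0) zs
  · simpa [equilibrium] using hasDerivWithinAt_const t (Set.Ici 0) ys
  obtain ⟨hy₀, hx₀⟩ := hp₀
  rw [← mem_balanced] at hy₀
  set E := ‖p₀ - equilibrium 𝒳 f φ xs‖ with hE
  have hz_le : ‖p₀.1 - zs‖ ≤ E := norm_fst_le (p₀ - equilibrium 𝒳 f φ xs)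
  have hy_le : ‖p₀.2.1 - ys‖ ≤ E :=
    (norm_fst_le (p₀ - equilibrium 𝒳 f φ xs).2).trans (norm_snd_le _)
  have hE0 : 0 ≤ E := norm_nonneg _
  have hu₀ : ‖((p₀.1 - zs, T (p₀.2.1 - ys)) : Stack n d × balanced n d)‖ ≤ N * E := by
    have h1 : 0 ≤ ‖T‖ := T.opNorm_nonneg
    refine max_le (hz_le.trans (by nlinarith)) ((T.le_opNorm _).trans ?_)
    nlinarith [norm_nonneg (p₀.2.1 - ys)]
  have hδ₁ : N * E ≤ δ := by
    rw [mul_comm, ← le_div_iff₀ hN0]; exact hp₀δ.trans (min_le_left _ _)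
  have hδ₂ : C * (N * E) ≤ r := by
    rw [← mul_assoc, mul_comm, ← le_div_iff₀ (by positivity)]
    exact hp₀δ.trans (min_le_right _ _)
  obtain ⟨u, hu0, hu, hudecay, huniq⟩ := hsol (p₀.1 - zs, T (p₀.2.1 - ys)) trivial
    (by rw [sub_zero]; exact hu₀.trans hδ₁)
  have hdecay : ∀ t, 0 ≤ t → ‖u t‖ ≤ C * (N * E) * Real.exp (-ρ * t) := fun t ht => by
    have h := hudecay t ht
    rw [sub_zero, sub_zero] at h
    exact h.trans (by gcongr)
  refine ⟨fun t => ((u t).1 + zs, ys + act (sqrtLap d G) ((u t).2 : Stack n d),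
    mirror 𝒳 φ ((u t).1 + zs)), ?_, fun t ht => ⟨?_, ?_, rfl⟩, fun t ht => ?_,
    fun T₁ hT₁ q hq0 hq => ?_⟩
  · simp only [hu0, sub_add_cancel]
    refine Prod.ext rfl (Prod.ext ?_ hx₀.symm)
    change ys + act (sqrtLap d G) (T (p₀.2.1 - ys) : Stack n d) = p₀.2.1
    rw [hST _ ((balanced n d).sub_mem hy₀ hys_bal), add_sub_cancel]
  · exact (hu t ht).fst.add_const zs
  · have h := (S ∘L (balanced n d).subtypeL).hasFDerivAt.comp_hasDerivWithinAt t (hu t ht).snd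
    have h2 : (S ∘L (balanced n d).subtypeL) (dualField 𝒳 f φ G xs (u t)).2 =
        act (bigLap d G) (mirror 𝒳 φ ((u t).1 + zs)) := (act_bigLap G _).symm
    rw [h2] at h
    exact h.const_add ys
  · have hexp : Real.exp (-ρ * t) ≤ 1 := Real.exp_le_one_iff.2 (by nlinarith)
    have hut : ‖u t‖ ≤ r := (hdecay t ht).trans
      ((mul_le_of_le_one_right (by positivity) hexp).trans hδ₂)
    have hfst : ‖(u t).1‖ ≤ ‖u t‖ := norm_fst_le _
    have h1 : ‖((u t).1 + zs) - zs‖ ≤ (1 + ‖S‖ + Km) * ‖u t‖ := by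
      rw [add_sub_cancel_right]
      refine hfst.trans (le_mul_of_one_le_left (norm_nonneg _) ?_)
      linarith [norm_nonneg S, Km.coe_nonneg]
    have h2 : ‖ys + act (sqrtLap d G) ((u t).2 : Stack n d) - ys‖ ≤ (1 + ‖S‖ + Km) * ‖u t‖ := by
      rw [add_sub_cancel_left]
      have h3 : ‖S (u t).2‖ ≤ ‖S‖ * ‖u t‖ :=
        (S.le_opNorm _).trans (mul_le_mul_of_nonneg_left (norm_snd_le (u t)) (norm_nonneg S))
      exact h3.trans (mul_le_mul_of_nonneg_right (by linarith [Km.coe_nonneg]) (norm_nonneg _))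
    have h3 : ‖mirror 𝒳 φ ((u t).1 + zs) - col fun _ => xs‖ ≤ (1 + ‖S‖ + Km) * ‖u t‖ :=
      (hmir _ (hfst.trans hut)).trans (mul_le_mul (by linarith [norm_nonneg S]) hfst
        (norm_nonneg _) (by positivity))
    have h4 : (1 + ‖S‖ + Km) * ‖u t‖ ≤ (1 + ‖S‖ + Km) * (C * N) * E * Real.exp (-ρ * t) := by
      rw [mul_assoc, mul_assoc (1 + ‖S‖ + (Km : ℝ)), mul_assoc C, ← mul_assoc, ← mul_assoc,
        mul_assoc (1 + ‖S‖ + (Km : ℝ)), mul_assoc (1 + ‖S‖ + (Km : ℝ))]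
      refine mul_le_mul_of_nonneg_left ((hdecay t ht).trans_eq ?_) (by positivity)
      ring
    exact (max_le h1 (max_le h2 h3)).trans h4
  -- Conservation of the sum keeps `y - y⋆` balanced along any competing solution, so `T` turns it
  -- into a solution of the transformed field, for which uniqueness is known.
  · have hbal : ∀ t ∈ Set.Icc 0 T₁, (q t).2.1 - ys ∈ balanced n d := fun t ht => by
      have h1 := hq.sub_mem_balanced ht
      rw [hq0] at h1
      have h2 := (balanced n d).add_mem h1 ((balanced n d).sub_mem hy₀ hys_bal)
      rwa [sub_add_sub_cancel] at h2
    have hv := huniq T₁ hT₁ (fun t => ((q t).1 - zs, T ((q t).2.1 - ys))) (by simp [hq0])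
      fun t ht => by
        obtain ⟨h1, h2, h3⟩ := hq t ht
        have h4 := T.hasFDerivAt.comp_hasDerivWithinAt t (h2.sub_const ys)
        refine ((h1.sub_const zs).prodMk h4).congr_deriv (Eq.symm (Prod.ext ?_ ?_))
        · simp only [dualField, sub_add_cancel, ← hzs, ← hys, ← h3, hST _ (hbal t ht)]
          rw [add_sub_cancel]
        · simp only [dualField, sub_add_cancel, ← hzs, ← h3]
          rw [act_bigLap]
          exact (hTS (sqrtLapBalanced G (q t).2.2)).symm
    intro t ht
    have h1 := hv ht
    obtain ⟨-, -, h3⟩ := hq t ht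
    simp only [← h1, sub_add_cancel, ← h3, hST _ (hbal t ht), add_sub_cancel]

end Original

end DMD

/-! ### The stability theorem -/

theorem theorem2 {n d : ℕ}
    -- the domain, the local costs and the network
    (𝒳 : Set (DMD.Vec d)) (f : Fin n → DMD.Vec d → ℝ)
    (G : SimpleGraph (Fin n)) [DecidableRel G.Adj] (hG : G.Connected)
    (hf_conv : ∀ i, ConvexOn ℝ 𝒳 (f i)) (hf_diff : ∀ i, DifferentiableOn ℝ (f i) 𝒳)
    -- the global cost and its minimizer
    (μF : ℝ) (hμF : 0 < μF) (hF : StrongConvexOn 𝒳 μF (fun x => ∑ i, f i x))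
    (xs : DMD.Vec d) (hxs : xs ∈ interior 𝒳) (hmin : IsMinOn (fun x => ∑ i, f i x) 𝒳 xs)
    (hf_C1 : ∀ i, ContDiffAt ℝ 1 (gradientWithin (f i) 𝒳) xs)
    -- the distance generating function
    (φ : DMD.Vec d → ℝ) (μφ : ℝ) (hμφ : 0 < μφ)
    (hφ_closed : IsClosed {p : DMD.Vec d × ℝ | p.1 ∈ 𝒳 ∧ φ p.1 ≤ p.2})
    (hφ_diff : DifferentiableOn ℝ φ (interior 𝒳)) (hφ_sc : StrongConvexOn 𝒳 μφ φ)
    (hφ_diff2 : ∀ᶠ x in 𝓝 xs, DifferentiableAt ℝ (gradient φ) x)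
    (hφ_C1 : ContDiffAt ℝ 1 (DMD.hessian φ) xs) :
    DMD.IsLocallyExpStable (DMD.IsSolution 𝒳 f φ G) (DMD.admissible n 𝒳 φ)
        (DMD.equilibrium 𝒳 f φ xs) ∧
      ∀ R : Matrix (Fin n) (Fin (n - 1)) ℝ, DMD.IsReduction G R →
        DMD.IsLocallyExpStable (DMD.IsReducedSolution 𝒳 f φ G R xs) Set.univ 0 := by
  open DMD in
  have hnhds : 𝒳 ∈ 𝓝 xs := mem_interior_iff_mem_nhds.1 hxs
  have hint : ∀ᶠ x in 𝓝 xs, x ∈ interior 𝒳 := isOpen_interior.mem_nhds hxs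
  -- derivatives at the minimizer
  have hgφ : ∀ᶠ x in 𝓝 xs, HasGradientAt φ (gradient φ x) x := hint.mono fun x hx =>
    (hφ_diff.differentiableAt (isOpen_interior.mem_nhds hx)).hasGradientAt
  have hgf : ∀ i, ∀ᶠ x in 𝓝 xs, HasGradientAt (f i) (gradientWithin (f i) 𝒳 x) x := fun i =>
    hint.mono fun x hx =>
      hasGradientAt_iff_hasFDerivAt.2 <|
        (hf_diff i x (interior_subset hx)).hasGradientWithinAt.hasFDerivWithinAt.hasFDerivAt
          (mem_interior_iff_mem_nhds.1 hx)
  have hgF : ∀ᶠ x in 𝓝 xs,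
      HasGradientAt (fun x => ∑ i, f i x) (∑ i, gradientWithin (f i) 𝒳 x) x := by
    filter_upwards [Filter.eventually_all.2 hgf] with x hx
    rw [hasGradientAt_iff_hasFDerivAt, map_sum]
    exact HasFDerivAt.fun_sum fun i _ => (hx i).hasFDerivAt
  -- Differentiability near the minimizer together with continuity of the Hessian there upgrades to
  -- strict differentiability.
  have hH : HasStrictFDerivAt (gradient φ) (hessian φ xs) xs :=
    hasStrictFDerivAt_of_hasFDerivAt_of_continuousAt (hφ_diff2.mono fun x hx => hx.hasFDerivAt)
      hφ_C1.continuousAt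
  obtain ⟨B, hB⟩ : ∃ B : Fin n → Vec d →L[ℝ] Vec d,
      ∀ i, HasStrictFDerivAt (gradientWithin (f i) 𝒳) (B i) xs :=
    ⟨_, fun i => (hf_C1 i).hasStrictFDerivAt one_ne_zero⟩
  have hHμ := StrongConvexOn.le_inner_deriv_gradient hφ_sc hnhds hgφ hH.hasFDerivAt
  obtain ⟨e, he⟩ := exists_inverse_of_coercive hμφ hHμ
  have hHcomm := inner_deriv_gradient_comm hgφ hH.hasFDerivAt
  rw [← he] at hH hHμ hHcomm
  have hB0 : ∀ i v, 0 ≤ ⟪B i v, v⟫_ℝ := fun i v => by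
    simpa using StrongConvexOn.le_inner_deriv_gradient (strongConvexOn_zero.2 (hf_conv i)) hnhds
      (hgf i) (hB i).hasFDerivAt v
  have hBF := StrongConvexOn.le_inner_deriv_gradient hF hnhds hgF
    (HasFDerivAt.fun_sum fun i _ => (hB i).hasFDerivAt)
  have hsum : ∑ i, gradientWithin (f i) 𝒳 xs = 0 :=
    gradient_eq_zero_of_isMinOn hnhds hmin hgF.self_of_nhds
  obtain ⟨κ, hκ, hKκ⟩ := exists_coercive_blockDiag_add_bigLap hG hB0 hμF hBF
  have hφ_conv : ConvexOn ℝ 𝒳 φ := strongConvexOn_zero.1 (hφ_sc.mono hμφ.le)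
  obtain ⟨hconj₀, hconj⟩ := hasStrictFDerivAt_gradient_conjugate hφ_conv hxs hφ_diff hH
  -- the linearizations
  set H : Stack n d →L[ℝ] Stack n d := blockDiag fun _ => (e : Vec d →L[ℝ] Vec d)
  have hHA : ∀ x, H (blockDiag (fun _ => (e.symm : Vec d →L[ℝ] Vec d)) x) = x := fun x =>
    stack_ext fun i => by simp [H]
  -- The two systems differ only in the multiplier space `W` and the coupling `D`: balanced vectors
  -- with `S` in (a), reduced coordinates with `S R` in (b).
  have hlin : ∀ {W : Type} [NormedAddCommGroup W] [InnerProductSpace ℝ W] [FiniteDimensional ℝ W]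
      {D : W →L[ℝ] Stack n d} {Dt : Stack n d →L[ℝ] W}, (∀ w, D w = 0 → w = 0) →
      (∀ x w, ⟪Dt x, w⟫_ℝ = ⟪x, D w⟫_ℝ) →
      HasLyapunovForm (saddleGen (blockDiag fun _ => (e.symm : Vec d →L[ℝ] Vec d))
        (blockDiag B + actL (bigLap d G)) D Dt) := by
    intro W _ _ _ D Dt hD hDt
    obtain ⟨σ, hσ, hDσ⟩ := exists_coercive (q := fun w => ‖D w‖ ^ 2) (by fun_prop)
      (fun c w => by rw [map_smul, norm_smul, mul_pow, Real.norm_eq_abs, sq_abs])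
      (fun w hw => by
        have : 0 < ‖D w‖ := norm_pos_iff.2 fun h => hw (hD w h)
        positivity)
    exact hasLyapunovForm_saddleGen hHA (blockDiag_comm fun _ => hHcomm) hμφ
      (le_inner_blockDiag fun _ => hHμ) hκ hKκ hσ hDσ hDt
  constructor
  · refine isLocallyExpStable_of_dualField hG (isLocallyExpStable_of_hasLyapunovForm ?_
      (hasStrictFDerivAt_dualField G hconj₀ hconj hB) (HasLyapunovForm.dualSaddleGen hHA
        (hlin (fun w hw => ?_) fun x w => inner_act_sqrtLap G x w))) hsum (mirror_dual hconj₀)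
      (hasStrictFDerivAt_mirror hconj)
    · refine Prod.ext ?_ (Subtype.ext ?_)
      · have h0 : act (sqrtLap d G) (0 : Stack n d) = 0 := map_zero (actL _)
        simp [dualField, mirror_dual hconj₀, h0]
      · refine (congrArg (act (sqrtLap d G)) ?_).trans (act_sqrtLap_const G xs)
        simp [mirror_dual hconj₀]
    · exact Subtype.ext
        (eq_zero_of_consensus_of_balanced (block_eq_of_act_sqrtLap_eq_zero hG hw) w.2)
  · intro R hR
    -- A connected graph has a vertex; this makes the factor `1 / √n` in the first column of `Q`
    -- nonzero.
    have : NeZero n := ⟨fun h => by subst h; exact hG.nonempty.elim Fin.elim0⟩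
    rw [isReducedSolution_iff]
    refine isLocallyExpStable_of_hasLyapunovForm ?_
      (hasStrictFDerivAt_reducedField G R he.symm hφ_C1 hB)
      (hlin (fun w hw => hR.act_injective hG hw) fun x w => inner_reduced R x w)
    have h0 : ∀ {m k : ℕ} (A : Matrix (Fin m × Fin d) (Fin k × Fin d) ℝ), act A 0 = 0 :=
      fun A => map_zero (actL A)
    refine Prod.ext ?_ ?_
    · refine stack_ext fun i => ?_
      simp [reducedField, h0, invHessianStack]
    · simp [reducedField, h0]
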